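/- Let $\mathcal{L}=\{(n,m)\in\mathbb{Z}^2 : n+m \text{ even},\ n\ge 0\}$ and let $p\in[0,1]$. Consider the oriented site percolation model on $\mathcal{L}$ in which the sites are occupied independently, each with probability $p$; an occupied site $(n,m)$ has arrows to $(n+1,m+1)$, $(n+2,m)$ and $(n+1,m-1)$, and a vacant site has no arrows. (This is oriented triangular site percolation, rotated and scaled.) Write $x\to y$ if there is a finite, possibly empty, path of arrows from $x$ to $y$. Let $\mathbf{C}_o=\{y\in\mathcal{L}: o\to y\}$ be the forward cluster of the origin $o=(0,0)$, and let $$p_c=\inf\{p\in[0,1] : \mathbb{P}_p(|\mathbf{C}_o|=\infty)>0\}.$$ For $n\ge 1$ let $$\overline{u}_n=\sup\{x : \text{there is } y\le 0 \text{ with } (0,y)\to(n,x) \text{ or } (1,y)\to(n,x)\}$$ (all points are in $\mathcal{L}$, and $\sup\varnothing=-\infty$), and define the edge speed $$\alpha[p]=\inf_{n\ge 1}\mathbb{E}_p\Big[\frac{\overline{u}_n}{n}\Big]\in[-\infty,1].$$ Then $\alpha[p_c]=0$, and $\alpha$ is finite and continuous on $[p_c,1]$. -/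

import Mathlib

open MeasureTheory

noncomputable section

namespace OTSP

/-- The lattice `𝓛 = {(n, m) ∈ ℤ² : n + m even, n ≥ 0}` of the rotated model. -/
abbrev Site : Type := {z : ℤ × ℤ // Even (z.1 + z.2) ∧ 0 ≤ z.1}

/-- The origin of the lattice. -/
def origin : Site := ⟨(0, 0), by simp⟩

/-- A label in `[0, 1]` at every site. -/
abbrev Labels : Type := Site → unitInterval

/-- The law under which the labels are i.i.d. uniform on `[0, 1]`. -/
def law : Measure Labels :=
  Measure.infinitePi fun _ : Site => (volume : Measure unitInterval)

/-- At parameter `p` the site `z` is occupied if its label is less than `p`; so for `p ∈ [0, 1]`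
the sites are occupied independently, each with probability `p`. -/
def Occupied (p : ℝ) (U : Labels) (z : Site) : Prop := (U z : ℝ) < p

/-- An occupied site `(n, m)` has arrows to `(n + 1, m + 1)`, `(n + 2, m)` and `(n + 1, m - 1)`;
a vacant site has none. -/
def Arrow (p : ℝ) (U : Labels) (a b : Site) : Prop :=
  Occupied p U a ∧
    (b.1 = a.1 + (1, 1) ∨ b.1 = a.1 + (2, 0) ∨ b.1 = a.1 + (1, -1))

/-- `a → b`: there is a finite (possibly empty) path of arrows from `a` to `b`. -/
def Connected (p : ℝ) (U : Labels) (a b : Site) : Prop :=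
  Relation.ReflTransGen (Arrow p U) a b

/-- The forward cluster of the origin. -/
def cluster (p : ℝ) (U : Labels) : Set Site := {b | Connected p U origin b}

/-- The probability that the forward cluster of the origin is infinite. -/
def percolationProb (p : ℝ) : ENNReal := law {U | (cluster p U).Infinite}

/-- The critical value: the infimum of the `p ∈ [0, 1]` with positive percolation probability. -/
def criticalValue : ℝ := sInf {p : ℝ | p ∈ Set.Icc (0 : ℝ) 1 ∧ 0 < percolationProb p}

/-- The heights `x` such that `(n, x)` can be reached from a site `(0, y)` or `(1, y)`
with `y ≤ 0`. -/
def reachedFromBelow (p : ℝ) (U : Labels) (n : ℕ) : Set ℤ :=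
  {x | ∃ a b : Site, (a.1.1 = 0 ∨ a.1.1 = 1) ∧ a.1.2 ≤ 0 ∧ b.1 = ((n : ℤ), x) ∧
    Connected p U a b}

/-- The upper edge at level `n`: the supremum of `reachedFromBelow p U n` in `[-∞, ∞]`
(equal to `-∞` if that set is empty). -/
def upperEdge (p : ℝ) (U : Labels) (n : ℕ) : EReal :=
  ⨆ x ∈ reachedFromBelow p U n, ((x : ℝ) : EReal)

/-- The expectation of an extended real random variable, as the difference of the integrals of
its positive and negative parts. It is used only for variables that are bounded above, where
it takes values in `[-∞, ∞)`. -/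
def expectation (X : Labels → EReal) : EReal :=
  ((∫⁻ U, (X U).toENNReal ∂law : ENNReal) : EReal) -
    ((∫⁻ U, (-X U).toENNReal ∂law : ENNReal) : EReal)

/-- The edge speed: the infimum over `n ≥ 1` of the expectation of `upperEdge p · n / n`. -/
def edgeSpeed (p : ℝ) : EReal :=
  ⨅ (n : ℕ) (_ : 1 ≤ n), expectation fun U => upperEdge p U n / (n : EReal)

end OTSP

end

/-! Write α for the edge speed and u_n for the upper edge. Monotonicity of α in `p` comes from
coupling all parameters through the same uniform labels, so two one-sided statements suffice.

From the right, α is an infimum over `n` and `K` of E[max(u_n, -K)]/n. Each of these means is a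
finite combination of probabilities of events on finitely many sites, and so is continuous from the
right; hence `exists_gt_edgeSpeed_lt`. Subadditivity of the edge and a Chernoff bound show that
P(u_m ≥ bm) tends to 0 whenever b > α (`tendsto_edgeGE_of_edgeSpeed_lt`). By reflection symmetry a
negative speed therefore excludes percolation, so α ≥ 0 above the critical value, and by right
semicontinuity also at it.

From the left, the main statement is `exists_lt_le_edgeSpeed`: if α(p) > b > 0, then some p' < p
still has speed at least b and percolates. Since the mean of u_n/n is at least α and its upper tail
vanishes, u_n/n concentrates at α. Thus long tubes of slope α and small relative width are crossed
with probability close to 1 (`exists_tube_compl_le`). One such crossing is a finite event, so it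
remains likely at some p' < p, and a renormalisation then runs at p' alone. Parallel tubes of slope
a > 0, each starting slightly lower than the end of its predecessor's first half, overlap in time; a
reflected tube of slope -a goes from above one to below the next, and by planarity the three
crossings form one path. This gives a longer lane, at a small loss of slope. A strip of twice the
width contains two disjoint strips, so its failure probability is squared, which beats the union
bound along the lane. With length ratios M * 2^k the losses of slope are summable.

Crossings at every scale give α(p') ≥ b; joining lanes of successive scales gives an infinite path
at p'. Were α positive at the critical value, percolation would occur below it. So α vanishes there,
and the same statement yields left continuity above it. -/

noncomputable section

namespace OTSP

/-! ### Paths as height functions -/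

/-- The point `(n, m)` is an occupied site of the lattice. -/
def Open (p : ℝ) (U : Labels) (n : ℕ) (m : ℤ) : Prop :=
  ∃ h : Even ((n : ℤ) + m) ∧ 0 ≤ (n : ℤ), Occupied p U ⟨((n : ℤ), m), h⟩

/-- `h` is the height function of an open path over the columns `s, …, e`. A column `n` with
`n + h n` odd is passed in the middle of an arrow of length two. -/
def IsPath (p : ℝ) (U : Labels) (h : ℕ → ℤ) (s e : ℕ) : Prop :=
  ∀ n, s ≤ n → n < e → (Open p U n (h n) ∧ |h (n + 1) - h n| ≤ 1) ∨
    (¬ Even ((n : ℤ) + h n) ∧ h (n + 1) = h n)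

variable {p p' : ℝ} {U : Labels} {f g h : ℕ → ℤ} {s t e : ℕ}

lemma Open.mono (hp : p ≤ p') {n : ℕ} {m : ℤ} (h : Open p U n m) : Open p' U n m :=
  let ⟨h1, h2⟩ := h
  ⟨h1, lt_of_lt_of_le h2 hp⟩

lemma Open.even {n : ℕ} {m : ℤ} (h : Open p U n m) : Even ((n : ℤ) + m) := h.1.1

lemma IsPath.mono (hp : p ≤ p') (h1 : IsPath p U h s e) : IsPath p' U h s e :=
  fun n hs he => (h1 n hs he).imp_left fun h2 => ⟨h2.1.mono hp, h2.2⟩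

lemma IsPath.sub {s' e' : ℕ} (h1 : IsPath p U h s e) (hs : s ≤ s') (he : e' ≤ e) :
    IsPath p U h s' e' :=
  fun n hn hn' => h1 n (hs.trans hn) (lt_of_lt_of_le hn' he)

lemma IsPath.congr (h1 : IsPath p U f s e) (hfg : ∀ n, s ≤ n → n ≤ e → f n = g n) :
    IsPath p U g s e := by
  intro n hs he
  rw [← hfg n hs he.le, ← hfg (n + 1) (by omega) (by omega)]
  exact h1 n hs he

lemma isPath_self : IsPath p U h s s := fun n h1 h2 => by omega

lemma IsPath.step (h1 : IsPath p U h s e) {n : ℕ} (hs : s ≤ n) (he : n < e) :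
    |h (n + 1) - h n| ≤ 1 := by
  rcases h1 n hs he with h2 | h2
  · exact h2.2
  · simp [h2.2]

lemma IsPath.dist (h1 : IsPath p U h s e) {m n : ℕ} (hs : s ≤ m) (hmn : m ≤ n) (he : n ≤ e) :
    |h n - h m| ≤ (n : ℤ) - m := by
  induction n, hmn using Nat.le_induction with
  | base => simp
  | succ n hmn ih =>
    have h2 := ih (by omega)
    have h3 := h1.step (hs.trans hmn) (show n < e by omega)
    push_cast
    rw [abs_le] at *
    constructor <;> linarith [h2.1, h2.2, h3.1, h3.2]

/-- Two paths that agree at column `t` can be joined there. -/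
lemma IsPath.glue (hf : IsPath p U f s t) (hg : IsPath p U g t e) (hst : s ≤ t) (hte : t ≤ e)
    (ht : f t = g t) : IsPath p U (fun n => if n ≤ t then f n else g n) s e := by
  intro n hs he
  rcases lt_trichotomy n t with h1 | h1 | h1
  · have h2 : n + 1 ≤ t := h1
    simp only [h1.le, h2, if_true]
    exact hf n hs h1
  · subst h1
    simp only [le_refl, if_true, show ¬ n + 1 ≤ n by omega, if_false, ht]
    exact hg n le_rfl he
  · simp only [show ¬ n ≤ t by omega, show ¬ n + 1 ≤ t by omega, if_false]
    exact hg n h1.le he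

/-- One step of two paths cannot make them pass each other. -/
lemma IsPath.not_jump (hf : IsPath p U f s e) (hg : IsPath p U g s e) {n : ℕ} (hs : s ≤ n)
    (he : n < e) (hlt : f n < g n) : f (n + 1) ≤ g (n + 1) := by
  rcases hf n hs he with ⟨h1, h2⟩ | ⟨h1, h2⟩ <;> rcases hg n hs he with ⟨h3, h4⟩ | ⟨h3, h4⟩
  -- Two lattice points of one column differ in height by an even number, so the gap is at least 2
  -- and each path closes at most 1 of it. In the other cases at most one path moves.
  · have h5 := h1.even
    have h6 := h3.even
    rw [abs_le] at h2 h4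
    rw [Int.even_iff] at h5 h6
    omega
  · rw [abs_le] at h2; omega
  · rw [abs_le] at h4; omega
  · omega

/-- Two paths that exchange their order meet. -/
lemma IsPath.exists_meet (hf : IsPath p U f s e) (hg : IsPath p U g s e) (hse : s ≤ e)
    (h1 : f s ≤ g s) (h2 : g e ≤ f e) : ∃ n, s ≤ n ∧ n ≤ e ∧ f n = g n := by
  by_contra hne
  push Not at hne
  have key : ∀ n, s ≤ n → n ≤ e → f n < g n := by
    intro n hn
    induction n, hn using Nat.le_induction with
    | base => exact fun _ => lt_of_le_of_ne h1 (hne s le_rfl hse)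
    | succ n hn ih =>
      intro he
      exact lt_of_le_of_ne (hf.not_jump hg hn (by omega) (ih (by omega)))
        (hne _ (by omega) he)
  exact absurd (key e hse le_rfl) (not_lt.2 h2)

/-- The column-height pairs of `f` over `s, …, e` lie in `S`. -/
def GraphIn (f : ℕ → ℤ) (s e : ℕ) (S : Set (ℕ × ℤ)) : Prop := ∀ n, s ≤ n → n ≤ e → (n, f n) ∈ S

/-- A path from `(s, y)` to `(e, x)` with graph in `S`. -/
def Reach (p : ℝ) (U : Labels) (S : Set (ℕ × ℤ)) (s : ℕ) (y : ℤ) (e : ℕ) (x : ℤ) : Prop :=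
  s ≤ e ∧ ∃ h, IsPath p U h s e ∧ GraphIn h s e S ∧ h s = y ∧ h e = x

lemma IsPath.reach {S : Set (ℕ × ℤ)} (h1 : IsPath p U f s e) (hS : GraphIn f s e S)
    {m n : ℕ} (hm : s ≤ m) (hmn : m ≤ n) (hn : n ≤ e) : Reach p U S m (f m) n (f n) :=
  ⟨hmn, f, h1.sub hm hn, fun k h2 h3 => hS k (by omega) (by omega), rfl, rfl⟩

lemma Reach.trans {S : Set (ℕ × ℤ)} {x y z : ℤ} (h1 : Reach p U S s x t y)
    (h2 : Reach p U S t y e z) : Reach p U S s x e z := by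
  obtain ⟨hst, f, hf, hfS, hfs, hft⟩ := h1
  obtain ⟨hte, g, hg, hgS, hgt, hge⟩ := h2
  refine ⟨hst.trans hte, _, hf.glue hg hst hte (hft.trans hgt.symm), ?_, ?_, ?_⟩
  · intro n hs he
    dsimp only
    split_ifs with h
    · exact hfS n hs h
    · exact hgS n (by omega) he
  · simp [hst, hfs]
  · split_ifs with h
    · obtain rfl : e = t := le_antisymm h hte
      rw [hft, ← hgt, hge]
    · exact hge

/-- A path that starts above another one and ends below a lower one leads from the former to the
latter. -/
lemma reach_of_connector {S : Set (ℕ × ℤ)} {f' : ℕ → ℤ} (hf : IsPath p U f s e)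
    (hg : IsPath p U g s e) (hf' : IsPath p U f' s e) (hse : s ≤ e)
    (hfS : GraphIn f s e S) (hgS : GraphIn g s e S) (hfS' : GraphIn f' s e S)
    (h1 : f s ≤ g s) (h2 : g e ≤ f' e) (h3 : ∀ n, s ≤ n → n ≤ e → f' n ≤ f n) :
    Reach p U S s (f s) e (f' e) := by
  -- Since `f'` runs below `f`, the connector `g` must meet `f` first; from there on it descends to
  -- meet `f'`. The joined path follows `f`, then `g`, then `f'`.
  obtain ⟨n, hn, hn', hfg⟩ := hf.exists_meet hg hse h1 (h2.trans (h3 e hse le_rfl))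
  obtain ⟨m, hm, hm', hgf⟩ := (hf'.sub hn le_rfl).exists_meet (hg.sub hn le_rfl) hn'
    ((h3 n hn hn').trans hfg.le) h2
  have r1 := hf.reach hfS le_rfl hn hn'
  rw [hfg] at r1
  have r2 := hg.reach hgS hn hm hm'
  rw [← hgf] at r2
  exact (r1.trans r2).trans (hf'.reach hfS' (hn.trans hm) hm' le_rfl)

/-! ### Paths and connections of sites -/

/-- An arrow of length two becomes two flat steps, the second one starting at a point of odd parity,
where no occupation is required. -/
lemma isPath_of_connected {a b : Site} (hab : Connected p U a b) :
    a.1.1 ≤ b.1.1 ∧ ∃ h, IsPath p U h a.1.1.toNat b.1.1.toNat ∧ h a.1.1.toNat = a.1.2 ∧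
      h b.1.1.toNat = b.1.2 := by
  induction hab with
  | refl => exact ⟨le_rfl, fun _ => a.1.2, isPath_self, rfl, rfl⟩
  | @tail b c hab hbc ih =>
    obtain ⟨hle, h, hp, ha, hb⟩ := ih
    obtain ⟨hocc, harr⟩ := hbc
    have hb0 := b.2.2
    have ha0 := a.2.2
    have hbe := b.2.1
    set m := b.1.1.toNat with hm
    have hm' : (m : ℤ) = b.1.1 := Int.toNat_of_nonneg hb0
    have hopen : Open p U m b.1.2 := by
      refine ⟨by rw [hm']; exact b.2, ?_⟩
      convert hocc
    have ham : a.1.1.toNat ≤ m := by omega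
    rw [Int.even_iff] at hbe
    have hval : c.1.1 = b.1.1 + 2 ∧ c.1.2 = b.1.2 ∨
        c.1.1 = b.1.1 + 1 ∧ |c.1.2 - b.1.2| ≤ 1 := by
      rcases harr with h1 | h1 | h1
      · right; simp [h1]
      · left; simp [h1]
      · right; simp [h1]
    rcases hval with ⟨h1, h2⟩ | ⟨h1, h2⟩
    · have hcm : c.1.1.toNat = m + 2 := by omega
      refine ⟨by omega, fun n => if n ≤ m then h n else b.1.2, ?_, ?_, ?_⟩
      · rw [hcm]
        refine hp.glue ?_ ham (by omega) hb
        intro n hn hn'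
        rcases (show n = m ∨ n = m + 1 by omega) with rfl | rfl
        · exact Or.inl ⟨hopen, by simp⟩
        · refine Or.inr ⟨?_, rfl⟩
          rw [Int.even_iff]; push_cast; omega
      · simp [ham, ha]
      · rw [hcm]; simp [h2]
    · have hcm : c.1.1.toNat = m + 1 := by omega
      refine ⟨by omega, fun n => if n ≤ m then h n else if n = m then b.1.2 else c.1.2, ?_, ?_, ?_⟩
      · rw [hcm]
        refine hp.glue (g := fun n => if n = m then b.1.2 else c.1.2) ?_ ham (by omega) (by simpa)
        intro n hn hn'
        obtain rfl : n = m := by omega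
        exact Or.inl ⟨by simpa using hopen, by simpa using h2⟩
      · simp [ham, ha]
      · rw [hcm]; simp

/-- The site at column `n` and height `m`. -/
def siteAt (n : ℕ) (m : ℤ) (h : Even ((n : ℤ) + m)) : Site :=
  ⟨((n : ℤ), m), h, Int.natCast_nonneg n⟩

/-- Arrows are peeled off from the end. If the last step leaves an odd point, the step before it was
a flat step from an open site, and both together are one arrow of length two; hence strong
induction. The even start ensures that this earlier column exists. -/
lemma IsPath.connected (hh : IsPath p U h s e) (hse : s ≤ e) (hs : Even ((s : ℤ) + h s))
    (he : Even ((e : ℤ) + h e)) : Connected p U (siteAt s (h s) hs) (siteAt e (h e) he) := by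
  induction e using Nat.strong_induction_on with
  | _ e ih =>
    rcases hse.eq_or_lt with rfl | hlt
    · exact Relation.ReflTransGen.refl
    obtain ⟨k, rfl⟩ : ∃ k, e = k + 1 := ⟨e - 1, by omega⟩
    have hke := he
    rw [Int.even_iff] at hke
    push_cast at hke
    rcases hh k (by omega) (by omega) with ⟨h1, h2⟩ | ⟨h1, h2⟩
    · refine (ih k (by omega) (hh.sub le_rfl (by omega)) (by omega) h1.even).tail ⟨h1.2, ?_⟩
      have h3 := h1.even
      rw [Int.even_iff] at h3
      rw [abs_le] at h2
      rcases (show h (k + 1) = h k + 1 ∨ h (k + 1) = h k - 1 by omega) with h4 | h4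
      · left; ext <;> simp [siteAt, h4]
      · right; right; ext <;> simp [siteAt, h4]; ring
    · rw [Int.even_iff] at h1
      have hsk : s < k := by
        rcases (show s ≤ k by omega).eq_or_lt with rfl | h3
        · rw [Int.even_iff] at hs; omega
        · exact h3
      obtain ⟨j, rfl⟩ : ∃ j, k = j + 1 := ⟨k - 1, by omega⟩
      push_cast at h1
      rcases hh j (by omega) (by omega) with ⟨h3, h4⟩ | ⟨h3, h4⟩
      · refine (ih j (by omega) (hh.sub le_rfl (by omega)) (by omega) h3.even).tail ⟨h3.2, ?_⟩
        have h5 := h3.even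
        rw [Int.even_iff] at h5
        rw [abs_le] at h4
        right; left
        have h6 : h (j + 1 + 1) = h j := by omega
        ext
        · simp [siteAt]; ring
        · simp [siteAt, h6]
      · rw [Int.even_iff] at h3; omega

/-! ### Symmetries and independence -/

instance : IsProbabilityMeasure law := by unfold law; infer_instance

/-- Translation of sites. -/
def shiftSite (s : ℕ) (y : ℤ) (hy : Even ((s : ℤ) + y)) (z : Site) : Site :=
  ⟨(z.1.1 + s, z.1.2 + y), by
    have h := z.2.1.add hy
    rwa [show z.1.1 + s + (z.1.2 + y) = z.1.1 + z.1.2 + (s + y) by ring], by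
    have := z.2.2
    simp only
    omega⟩

/-- The labels as seen from the site `(s, y)`. -/
def shift (s : ℕ) (y : ℤ) (hy : Even ((s : ℤ) + y)) (U : Labels) : Labels :=
  fun z => U (shiftSite s y hy z)

/-- Reflection of sites. -/
def mirrorSite (z : Site) : Site :=
  ⟨(z.1.1, -z.1.2), by
    have h := z.2.1
    rw [Int.even_iff] at h ⊢
    simp only
    omega, z.2.2⟩

/-- The reflected labels. -/
def mirror (U : Labels) : Labels := fun z => U (mirrorSite z)

lemma measurePreserving_shift (s : ℕ) (y : ℤ) (hy : Even ((s : ℤ) + y)) :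
    MeasurePreserving (shift s y hy) law law := by
  refine ⟨measurable_pi_lambda _ fun z => measurable_pi_apply _, ?_⟩
  refine Measure.map_infinitePi_infinitePi_of_inj (f := shiftSite s y hy)
    (P := fun _ : Site => (volume : Measure unitInterval)) ?_
  intro a b hab
  simp only [shiftSite, Subtype.mk.injEq, Prod.mk.injEq, add_left_inj] at hab
  exact Subtype.ext (Prod.ext hab.1 hab.2)

lemma measurePreserving_mirror : MeasurePreserving mirror law law := by
  refine ⟨measurable_pi_lambda _ fun z => measurable_pi_apply _, ?_⟩
  refine Measure.map_infinitePi_infinitePi_of_inj (f := mirrorSite)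
    (P := fun _ : Site => (volume : Measure unitInterval)) ?_
  intro a b hab
  simp only [mirrorSite, Subtype.mk.injEq, Prod.mk.injEq, neg_inj] at hab
  exact Subtype.ext (Prod.ext hab.1 hab.2)

/-- The σ-algebra of the labels in `S`. -/
abbrev sigma (S : Set Site) : MeasurableSpace Labels :=
  ⨆ z ∈ S, MeasurableSpace.comap (fun U : Labels => U z) inferInstance

lemma sigma_le (S : Set Site) : sigma S ≤ (inferInstance : MeasurableSpace Labels) :=
  iSup₂_le fun z _ => (measurable_pi_apply z).comap_le

lemma law_inter_of_disjoint {S T : Set Site} (hST : Disjoint S T) {A B : Set Labels}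
    (hA : MeasurableSet[sigma S] A) (hB : MeasurableSet[sigma T] B) :
    law (A ∩ B) = law A * law B := by
  have h1 : ProbabilityTheory.iIndepFun (fun (z : Site) (U : Labels) => U z) law :=
    ProbabilityTheory.iIndepFun_infinitePi
      (P := fun _ : Site => (volume : Measure unitInterval)) (X := fun _ x => x)
      (fun _ => measurable_id)
  have h2 := ProbabilityTheory.indep_iSup_of_disjoint
    (fun z => (measurable_pi_apply z).comap_le) h1 hST
  exact (ProbabilityTheory.Indep_iff _ _ _).1 h2 A B hA hB

lemma measurableSet_open {S : Set Site} {n : ℕ} {m : ℤ}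
    (hS : ∀ hev : Even ((n : ℤ) + m), siteAt n m hev ∈ S) :
    MeasurableSet[sigma S] {U | Open p U n m} := by
  by_cases hev : Even ((n : ℤ) + m)
  · have h1 : {U | Open p U n m} =
        (fun U : Labels => U (siteAt n m hev)) ⁻¹' {x : unitInterval | (x : ℝ) < p} := by
      ext U
      exact ⟨fun h => h.2, fun h => ⟨⟨hev, Int.natCast_nonneg n⟩, h⟩⟩
    rw [h1]
    have h2 : MeasurableSpace.comap (fun U : Labels => U (siteAt n m hev)) inferInstance
        ≤ sigma S := le_iSup₂_of_le (siteAt n m hev) (hS hev) le_rfl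
    exact h2 _ ⟨_, measurableSet_lt measurable_subtype_coe measurable_const, rfl⟩
  · have h1 : {U | Open p U n m} = ∅ := by
      ext U
      simpa using fun h : Open p U n m => hev h.even
    rw [h1]
    exact @MeasurableSet.empty _ (sigma S)

/-- There is a path over the columns `s, …, e` with the property `C`. -/
def pathEvent (p : ℝ) (s e : ℕ) (C : (ℕ → ℤ) → Prop) : Set Labels :=
  {U | ∃ h, IsPath p U h s e ∧ C h}

/-- The property `C` of height functions only concerns the columns `s, …, e`. -/
def IsLocal (s e : ℕ) (C : (ℕ → ℤ) → Prop) : Prop :=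
  ∀ ⦃f g : ℕ → ℤ⦄, (∀ n, s ≤ n → n ≤ e → f n = g n) → C f → C g

lemma pathEvent_mono (hp : p ≤ p') {C C' : (ℕ → ℤ) → Prop} (hC : ∀ h, C h → C' h) :
    pathEvent p s e C ⊆ pathEvent p' s e C' :=
  fun _ ⟨h, h1, h2⟩ => ⟨h, h1.mono hp, hC h h2⟩

lemma measurableSet_isPath {S : Set Site}
    (hS : ∀ n, s ≤ n → n < e → ∀ hev : Even ((n : ℤ) + h n), siteAt n (h n) hev ∈ S) :
    MeasurableSet[sigma S] {U | IsPath p U h s e} := by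
  have h1 : {U | IsPath p U h s e} = ⋂ n, ⋂ (_ : s ≤ n), ⋂ (_ : n < e),
      ({U | Open p U n (h n)} ∩ {_U | |h (n + 1) - h n| ≤ 1}) ∪
        {_U | ¬ Even ((n : ℤ) + h n) ∧ h (n + 1) = h n} := by
    ext U
    simp [IsPath]
  rw [h1]
  refine @MeasurableSet.iInter _ _ (sigma S) _ _ fun n => ?_
  refine @MeasurableSet.iInter _ _ (sigma S) _ _ fun hn => ?_
  refine @MeasurableSet.iInter _ _ (sigma S) _ _ fun hn' => ?_
  exact @MeasurableSet.union _ (sigma S) _ _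
    (@MeasurableSet.inter _ (sigma S) _ _ (measurableSet_open (hS n hn hn'))
      (@MeasurableSet.const _ (sigma S) _)) (@MeasurableSet.const _ (sigma S) _)

/-- By locality only the heights on finitely many columns matter, so the event is a countable union
over height functions. The last column `e` is never read, which makes consecutive blocks of columns
independent. -/
lemma measurableSet_pathEvent_sigma {C : (ℕ → ℤ) → Prop} (hC : IsLocal s e C) {S : Set Site}
    (hS : ∀ h, C h → ∀ n, s ≤ n → n < e → ∀ hev : Even ((n : ℤ) + h n),
      siteAt n (h n) hev ∈ S) :
    MeasurableSet[sigma S] (pathEvent p s e C) := by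
  let extend : (Fin (e + 1) → ℤ) → ℕ → ℤ := fun g n => if hn : n < e + 1 then g ⟨n, hn⟩ else 0
  have h1 : pathEvent p s e C =
      ⋃ g : Fin (e + 1) → ℤ, ⋃ (_ : C (extend g)), {U | IsPath p U (extend g) s e} := by
    apply Set.Subset.antisymm
    · rintro U ⟨h, hp, hCh⟩
      have h2 : ∀ n, s ≤ n → n ≤ e → h n = extend (fun i => h i) n := by
        intro n _ hn
        simp only [extend, dif_pos (show n < e + 1 by omega)]
      simp only [Set.mem_iUnion]
      exact ⟨fun i => h i, hC h2 hCh, hp.congr h2⟩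
    · intro U hU
      simp only [Set.mem_iUnion] at hU
      obtain ⟨g, hg, hp⟩ := hU
      exact ⟨_, hp, hg⟩
  rw [h1]
  refine @MeasurableSet.iUnion _ _ (sigma S) _ _ fun g => ?_
  exact @MeasurableSet.iUnion _ _ (sigma S) _ _ fun hg => measurableSet_isPath (hS _ hg)

lemma measurableSet_pathEvent {C : (ℕ → ℤ) → Prop} (hC : IsLocal s e C) :
    MeasurableSet (pathEvent p s e C) :=
  sigma_le Set.univ _ (measurableSet_pathEvent_sigma hC fun _ _ _ _ _ _ => Set.mem_univ _)

lemma open_shift_iff {y : ℤ} (hy : Even ((s : ℤ) + y)) {n : ℕ} {m : ℤ} :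
    Open p (shift s y hy U) n m ↔ Open p U (n + s) (m + y) := by
  constructor
  · rintro ⟨h1, h2⟩
    refine ⟨⟨?_, by positivity⟩, ?_⟩
    · have := h1.1.add hy
      push_cast
      rwa [show (n : ℤ) + s + (m + y) = n + m + (s + y) by ring]
    · unfold Occupied at h2 ⊢
      convert h2 using 3
      simp only [Nat.cast_add]
      rfl
  · rintro ⟨h1, h2⟩
    have h3 : Even ((n : ℤ) + m) := by
      have := h1.1.sub hy
      push_cast at this
      rwa [show (n : ℤ) + s + (m + y) - (s + y) = n + m by ring] at this
    refine ⟨⟨h3, by positivity⟩, ?_⟩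
    unfold Occupied at h2 ⊢
    convert h2 using 3
    simp only [Nat.cast_add]
    rfl

lemma IsPath.of_shift {y : ℤ} (hy : Even ((s : ℤ) + y)) {a b : ℕ}
    (hh : IsPath p (shift s y hy U) h a b) :
    IsPath p U (fun n => h (n - s) + y) (a + s) (b + s) := by
  intro n hn hn'
  obtain ⟨k, rfl⟩ : ∃ k, n = k + s := ⟨n - s, by omega⟩
  have h1 := hh k (by omega) (by omega)
  rw [open_shift_iff] at h1
  simp only [show k + s - s = k by omega, show k + s + 1 - s = k + 1 by omega]
  refine h1.imp (fun h2 => ⟨h2.1, by simpa using h2.2⟩) fun h2 => ⟨?_, by rw [h2.2]⟩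
  have h3 := h2.1
  rw [Int.even_iff] at h3 hy ⊢
  push_cast
  omega

lemma IsPath.to_shift {y : ℤ} (hy : Even ((s : ℤ) + y)) {a b : ℕ}
    (hh : IsPath p U h (a + s) (b + s)) :
    IsPath p (shift s y hy U) (fun n => h (n + s) - y) a b := by
  intro n hn hn'
  have h1 := hh (n + s) (by omega) (by omega)
  rw [open_shift_iff]
  simp only [show n + 1 + s = n + s + 1 by ring, sub_add_cancel]
  refine h1.imp (fun h2 => ⟨h2.1, by simpa using h2.2⟩) fun h2 => ⟨?_, by rw [h2.2]⟩
  have h3 := h2.1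
  rw [Int.even_iff] at h3 hy ⊢
  push_cast at h3
  omega

lemma Open.mirror {n : ℕ} {m : ℤ} (h1 : Open p (mirror U) n m) : Open p U n (-m) := by
  obtain ⟨h1, h2⟩ := h1
  refine ⟨⟨?_, h1.2⟩, h2⟩
  have := h1.1
  rw [Int.even_iff] at this ⊢
  omega

lemma IsPath.of_mirror (hh : IsPath p (mirror U) h s e) : IsPath p U (fun n => -h n) s e := by
  intro n hn hn'
  refine (hh n hn hn').imp (fun h2 => ⟨h2.1.mirror, ?_⟩) fun h2 => ⟨?_, by simp [h2.2]⟩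
  · rw [← abs_neg]
    convert h2.2 using 2
    ring
  · have := h2.1
    rw [Int.even_iff] at this ⊢
    dsimp only
    omega

lemma mirror_mirror : mirror (mirror U) = U := by
  funext z
  simp [mirror, mirrorSite]

lemma measureReal_shift_preimage {y : ℤ} (hy : Even ((s : ℤ) + y)) {E : Set Labels}
    (hE : MeasurableSet E) : law.real (shift s y hy ⁻¹' E) = law.real E :=
  (measurePreserving_shift s y hy).measureReal_preimage hE.nullMeasurableSet

lemma measureReal_mirror_preimage {E : Set Labels}
    (hE : MeasurableSet E) : law.real (mirror ⁻¹' E) = law.real E :=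
  measurePreserving_mirror.measureReal_preimage hE.nullMeasurableSet

/-! ### The upper edge -/

/-- The upper edge at level `n` is at least `x`. -/
def edgeGE (p : ℝ) (n : ℕ) (x : ℤ) : Set Labels :=
  pathEvent p 0 n fun h => h 0 ≤ 0 ∧ x ≤ h n

lemma isLocal_edge (n : ℕ) (x : ℤ) : IsLocal 0 n fun h => h 0 ≤ 0 ∧ x ≤ h n := by
  intro f g hfg hf
  rwa [← hfg 0 le_rfl (Nat.zero_le n), ← hfg n (Nat.zero_le n) le_rfl]

lemma measurableSet_edgeGE (p : ℝ) (n : ℕ) (x : ℤ) : MeasurableSet (edgeGE p n x) :=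
  measurableSet_pathEvent (isLocal_edge n x)

lemma edgeGE_mono (hp : p ≤ p') {n : ℕ} {x x' : ℤ} (hx : x ≤ x') :
    edgeGE p n x' ⊆ edgeGE p' n x :=
  pathEvent_mono hp fun _ h => ⟨h.1, hx.trans h.2⟩

lemma le_of_mem_edgeGE {n : ℕ} {x : ℤ} (hU : U ∈ edgeGE p n x) : x ≤ n := by
  obtain ⟨h, h1, h2, h3⟩ := hU
  have := h1.dist le_rfl (Nat.zero_le n) le_rfl
  rw [abs_le] at this
  push_cast at this
  linarith [this.2]

lemma edge_cases (p : ℝ) (U : Labels) (n : ℕ) : (∀ x, U ∉ edgeGE p n x) ∨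
    ∃ m : ℤ, m ≤ n ∧ ∀ x, U ∈ edgeGE p n x ↔ x ≤ m := by
  by_cases h : ∃ x, U ∈ edgeGE p n x
  · right
    obtain ⟨m, hm, hmax⟩ := Int.exists_greatest_of_bdd (P := fun x => U ∈ edgeGE p n x)
      ⟨n, fun x hx => le_of_mem_edgeGE hx⟩ h
    exact ⟨m, le_of_mem_edgeGE hm, fun x => ⟨hmax x, fun hx => edgeGE_mono le_rfl hx hm⟩⟩
  · left
    push Not at h
    exact h

/-- A path ending mid-arrow has just left an open site; taking the upward arrow there instead ends
at a lattice site that is even higher. -/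
lemma exists_even_end {n : ℕ} (hn : 1 ≤ n) {x : ℤ} (hU : U ∈ edgeGE p n x) :
    ∃ h, IsPath p U h 0 n ∧ h 0 ≤ 0 ∧ x ≤ h n ∧ Even ((n : ℤ) + h n) := by
  obtain ⟨h, h1, h2, h3⟩ := hU
  by_cases hev : Even ((n : ℤ) + h n)
  · exact ⟨h, h1, h2, h3, hev⟩
  obtain ⟨k, rfl⟩ : ∃ k, n = k + 1 := ⟨n - 1, by omega⟩
  have hodd := hev
  rw [Int.even_iff] at hodd
  push_cast at hodd
  have hk : Open p U k (h k) ∧ h (k + 1) = h k := by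
    rcases h1 k (Nat.zero_le k) (by omega) with ⟨h4, h5⟩ | ⟨h4, h5⟩
    · refine ⟨h4, ?_⟩
      have h6 := h4.even
      rw [Int.even_iff] at h6
      rw [abs_le] at h5
      omega
    · rw [Int.even_iff] at h4
      omega
  refine ⟨Function.update h (k + 1) (h k + 1), ?_, ?_, ?_, ?_⟩
  · intro m hm hm'
    rw [Function.update_of_ne (by omega)]
    rcases (show m < k ∨ m = k by omega) with h4 | rfl
    · rw [Function.update_of_ne (by omega)]
      exact h1 m hm hm'
    · rw [Function.update_self]
      exact Or.inl ⟨hk.1, by simp⟩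
  · rwa [Function.update_of_ne (by omega)]
  · rw [Function.update_self]; omega
  · rw [Function.update_self, Int.even_iff]; push_cast; omega

/-- A start at `(1, y)` is a start at `(0, y)` in the middle of an arrow, which needs no open site.
This is why the two initial columns match the single column 0 of height functions. -/
lemma mem_edgeGE_of_mem_reached {n : ℕ} {x : ℤ} (hx : x ∈ reachedFromBelow p U n) :
    U ∈ edgeGE p n x := by
  obtain ⟨a, b, ha, ha', hb, hab⟩ := hx
  obtain ⟨hle, h, hp, h1, h2⟩ := isPath_of_connected hab
  have hbn : b.1.1.toNat = n := by simp [hb]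
  have hbx : b.1.2 = x := by simp [hb]
  rw [hbn] at hp h2
  rcases ha with ha | ha
  · have ha0 : a.1.1.toNat = 0 := by simp [ha]
    rw [ha0] at hp h1
    exact ⟨h, hp, by omega, by omega⟩
  · have ha0 : a.1.1.toNat = 1 := by simp [ha]
    rw [ha0] at hp h1
    have hev := a.2.1
    rw [ha] at hev
    have hn : 1 ≤ n := by
      rw [ha, hb] at hle
      simp only at hle
      omega
    refine ⟨fun k => h (max k 1), ?_, ?_, ?_⟩
    · intro k hk hk'
      rcases (show k = 0 ∨ 1 ≤ k by omega) with rfl | hk1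
      · right
        refine ⟨?_, by simp⟩
        rw [Int.even_iff] at hev ⊢
        simp only [max_eq_right (Nat.zero_le 1)]
        omega
      · simp only [max_eq_left hk1, max_eq_left (show 1 ≤ k + 1 by omega)]
        exact hp k hk1 hk'
    · simp [h1, ha']
    · simp [max_eq_left hn, h2, hbx]

lemma exists_mem_reached {n : ℕ} (hn : 1 ≤ n) {x : ℤ} (hU : U ∈ edgeGE p n x) :
    ∃ y ∈ reachedFromBelow p U n, x ≤ y := by
  obtain ⟨h, h1, h2, h3, hev⟩ := exists_even_end hn hU
  refine ⟨h n, ?_, h3⟩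
  by_cases h0 : Even (((0 : ℕ) : ℤ) + h 0)
  · exact ⟨_, _, Or.inl rfl, h2, rfl, h1.connected (Nat.zero_le n) h0 hev⟩
  · have h4 : h 1 = h 0 := by
      rcases h1 0 le_rfl (by omega) with h4 | h4
      · exact absurd h4.1.even h0
      · exact h4.2
    have h5 : Even (((1 : ℕ) : ℤ) + h 1) := by
      rw [Int.even_iff] at h0 ⊢
      push_cast at *
      omega
    exact ⟨_, _, Or.inr rfl, h4.trans_le h2, rfl,
      (h1.sub (Nat.zero_le 1) le_rfl).connected hn h5 hev⟩

lemma upperEdge_eq_bot {n : ℕ} (hU : ∀ x, U ∉ edgeGE p n x) : upperEdge p U n = ⊥ := by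
  unfold upperEdge
  simp only [iSup_eq_bot]
  exact fun x hx => absurd (mem_edgeGE_of_mem_reached hx) (hU x)

lemma upperEdge_eq {n : ℕ} (hn : 1 ≤ n) {m : ℤ} (hU : ∀ x, U ∈ edgeGE p n x ↔ x ≤ m) :
    upperEdge p U n = ((m : ℝ) : EReal) := by
  apply le_antisymm
  · refine iSup₂_le fun x hx => ?_
    have := (hU x).1 (mem_edgeGE_of_mem_reached hx)
    exact_mod_cast this
  · obtain ⟨y, hy, hmy⟩ := exists_mem_reached hn ((hU m).2 le_rfl)
    refine le_trans ?_ (le_iSup₂_of_le y hy le_rfl)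
    exact_mod_cast hmy

/-- The upper edge, truncated below at `-K`. -/
def truncEdge (p : ℝ) (n K : ℕ) (U : Labels) : ℝ :=
  -K + ∑ x ∈ Finset.Ioc (-(K : ℤ)) n, (edgeGE p n x).indicator 1 U

lemma truncEdge_eq_of_forall_notMem {n K : ℕ} (hU : ∀ x, U ∉ edgeGE p n x) :
    truncEdge p n K U = -K := by
  unfold truncEdge
  rw [Finset.sum_eq_zero fun x _ => Set.indicator_of_notMem (hU x) _, add_zero]

lemma truncEdge_eq {n K : ℕ} {m : ℤ} (hm : m ≤ n) (hU : ∀ x, U ∈ edgeGE p n x ↔ x ≤ m) :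
    truncEdge p n K U = max (m : ℝ) (-K) := by
  have h1 : ∑ x ∈ Finset.Ioc (-(K : ℤ)) n, (edgeGE p n x).indicator (1 : Labels → ℝ) U =
      ((Finset.Ioc (-(K : ℤ)) m).card : ℝ) := by
    rw [Finset.card_eq_sum_ones, Nat.cast_sum]
    rw [← Finset.sum_subset (Finset.Ioc_subset_Ioc_right hm)]
    · refine Finset.sum_congr rfl fun x hx => ?_
      rw [Set.indicator_of_mem ((hU x).2 (Finset.mem_Ioc.1 hx).2)]
      simp
    · intro x hx hx'
      refine Set.indicator_of_notMem (fun hmem => hx' ?_) _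
      exact Finset.mem_Ioc.2 ⟨(Finset.mem_Ioc.1 hx).1, (hU x).1 hmem⟩
  unfold truncEdge
  rw [h1, Int.card_Ioc]
  rcases le_total m (-K) with h2 | h2
  · rw [Int.toNat_of_nonpos (by omega), max_eq_right (by exact_mod_cast h2)]
    simp
  · rw [max_eq_left (by exact_mod_cast h2)]
    have h3 : (((m - -(K : ℤ)).toNat : ℤ) : ℝ) = ((m - -(K : ℤ) : ℤ) : ℝ) := by
      rw [Int.toNat_of_nonneg (by omega)]
    rw [Int.cast_natCast] at h3
    rw [h3]
    push_cast
    ring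

lemma truncEdge_le {n K : ℕ} : truncEdge p n K U ≤ n := by
  rcases edge_cases p U n with hU | ⟨m, hm, hU⟩
  · rw [truncEdge_eq_of_forall_notMem hU]
    have : (0 : ℝ) ≤ n + K := by positivity
    linarith
  · rw [truncEdge_eq hm hU]
    have : (0 : ℝ) ≤ n + K := by positivity
    exact max_le (by exact_mod_cast hm) (by linarith)

lemma neg_le_truncEdge {n K : ℕ} : -(K : ℝ) ≤ truncEdge p n K U := by
  rcases edge_cases p U n with hU | ⟨m, hm, hU⟩
  · rw [truncEdge_eq_of_forall_notMem hU]
  · rw [truncEdge_eq hm hU]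
    exact le_max_right _ _

lemma le_truncEdge_of_mem {n K : ℕ} {x : ℤ} (hx : U ∈ edgeGE p n x) :
    (x : ℝ) ≤ truncEdge p n K U := by
  rcases edge_cases p U n with hU | ⟨m, hm, hU⟩
  · exact absurd hx (hU x)
  · rw [truncEdge_eq hm hU]
    exact le_max_of_le_left (by exact_mod_cast (hU x).1 hx)

lemma measurable_truncEdge (p : ℝ) (n K : ℕ) : Measurable (truncEdge p n K) := by
  unfold truncEdge
  refine measurable_const.add (Finset.measurable_sum _ fun x _ => ?_)
  exact measurable_one.indicator (measurableSet_edgeGE p n x)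

lemma integrable_of_bounds {X : Labels → ℝ} (hX : Measurable X) {A B : ℝ} (hA : ∀ U, A ≤ X U)
    (hB : ∀ U, X U ≤ B) : Integrable X law :=
  Integrable.of_bound hX.aestronglyMeasurable (max |A| |B|)
    (Filter.Eventually.of_forall fun U => abs_le_max_abs_abs (hA U) (hB U))

lemma integrable_truncEdge (p : ℝ) (n K : ℕ) : Integrable (truncEdge p n K) law :=
  integrable_of_bounds (measurable_truncEdge p n K) (fun _ => neg_le_truncEdge)
    fun _ => truncEdge_le

/-- A layer-cake sum: the mean inherits continuity in `p` from finitely many edge probabilities. -/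
lemma integral_truncEdge (p : ℝ) (n K : ℕ) : ∫ U, truncEdge p n K U ∂law =
    -K + ∑ x ∈ Finset.Ioc (-(K : ℤ)) n, law.real (edgeGE p n x) := by
  have h1 : ∀ x ∈ Finset.Ioc (-(K : ℤ)) n,
      Integrable ((edgeGE p n x).indicator (1 : Labels → ℝ)) law := fun x _ =>
    (integrable_const (1 : ℝ)).indicator (measurableSet_edgeGE p n x)
  unfold truncEdge
  rw [integral_add (integrable_const _) (integrable_finsetSum _ h1), integral_finsetSum _ h1]
  simp [integral_indicator_one, measurableSet_edgeGE]

/-! ### Expectations of extended real variables -/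

lemma expectation_mono_ae {X Y : Labels → EReal} (h : ∀ᵐ U ∂law, X U ≤ Y U) :
    expectation X ≤ expectation Y := by
  refine EReal.sub_le_sub ?_ ?_
  · refine EReal.coe_ennreal_le_coe_ennreal_iff.2 (lintegral_mono_ae ?_)
    filter_upwards [h] with U hU using EReal.toENNReal_le_toENNReal hU
  · refine EReal.coe_ennreal_le_coe_ennreal_iff.2 (lintegral_mono_ae ?_)
    filter_upwards [h] with U hU using EReal.toENNReal_le_toENNReal (EReal.neg_le_neg_iff.2 hU)

lemma expectation_mono {X Y : Labels → EReal} (h : ∀ U, X U ≤ Y U) :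
    expectation X ≤ expectation Y := expectation_mono_ae (Filter.Eventually.of_forall h)

lemma expectation_coe {X : Labels → ℝ} (hX : Integrable X law) :
    expectation (fun U => (X U : EReal)) = ((∫ U, X U ∂law : ℝ) : EReal) := by
  have h1 : ∫⁻ U, ENNReal.ofReal (X U) ∂law ≠ ⊤ := (hX.lintegral_lt_top).ne
  have h2 : ∫⁻ U, ENNReal.ofReal (-X U) ∂law ≠ ⊤ := (hX.neg.lintegral_lt_top).ne
  rw [integral_eq_lintegral_pos_part_sub_lintegral_neg_part hX]
  unfold expectation
  simp only [← EReal.coe_neg, EReal.real_coe_toENNReal]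
  rw [EReal.coe_sub, EReal.coe_ennreal_toReal h1, EReal.coe_ennreal_toReal h2]

lemma upperEdge_div_le {n : ℕ} {X : ℝ} (hX : ∀ x : ℤ, U ∈ edgeGE p n x → x ≤ X) :
    upperEdge p U n / (n : EReal) ≤ ((X / n : ℝ) : EReal) := by
  rw [EReal.coe_div, EReal.coe_natCast]
  refine EReal.div_le_div_right_of_nonneg (by exact_mod_cast Nat.zero_le n) ?_
  refine iSup₂_le fun x hx => ?_
  exact_mod_cast hX x (mem_edgeGE_of_mem_reached hx)

lemma edgeSpeed_le {n : ℕ} (hn : 1 ≤ n) {X : Labels → ℝ} (hX : Integrable X law)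
    (h : ∀ U, ∀ x : ℤ, U ∈ edgeGE p n x → x ≤ X U) :
    edgeSpeed p ≤ (((∫ U, X U ∂law) / n : ℝ) : EReal) := by
  refine (iInf₂_le n hn).trans ?_
  rw [← integral_div, ← expectation_coe (hX.div_const _)]
  exact expectation_mono fun U => upperEdge_div_le (h U)

/-- Truncating at a nonpositive level leaves the positive part alone, so only the negative part
needs a limit in `K`. -/
lemma toENNReal_upperEdge_div {n : ℕ} (hn : 1 ≤ n) (K : ℕ) :
    (upperEdge p U n / (n : EReal)).toENNReal = ENNReal.ofReal (truncEdge p n K U / n) := by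
  have hn0 : (0 : ℝ) < n := by exact_mod_cast hn
  rcases edge_cases p U n with hU | ⟨m, hm, hU⟩
  · rw [truncEdge_eq_of_forall_notMem hU, upperEdge_eq_bot hU,
      EReal.bot_div_of_pos_ne_top (by exact_mod_cast hn) (EReal.natCast_ne_top n),
      EReal.toENNReal_bot, ENNReal.ofReal_of_nonpos]
    exact div_nonpos_of_nonpos_of_nonneg (by simp) hn0.le
  · rw [truncEdge_eq hm hU, upperEdge_eq hn hU, ← EReal.coe_natCast, ← EReal.coe_div,
      EReal.real_coe_toENNReal]
    rcases le_total 0 (m : ℝ) with h0 | h0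
    · rw [max_eq_left (h0.trans' (by simp))]
    · rw [ENNReal.ofReal_of_nonpos (div_nonpos_of_nonpos_of_nonneg h0 hn0.le),
        ENNReal.ofReal_of_nonpos
          (div_nonpos_of_nonpos_of_nonneg (max_le h0 (by simp)) hn0.le)]

lemma toENNReal_neg_upperEdge_div {n : ℕ} (hn : 1 ≤ n) :
    (-(upperEdge p U n / (n : EReal))).toENNReal =
      ⨆ K : ℕ, ENNReal.ofReal (-(truncEdge p n K U / n)) := by
  have hn0 : (0 : ℝ) < n := by exact_mod_cast hn
  rcases edge_cases p U n with hU | ⟨m, hm, hU⟩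
  · rw [upperEdge_eq_bot hU,
      EReal.bot_div_of_pos_ne_top (by exact_mod_cast hn) (EReal.natCast_ne_top n),
      EReal.neg_bot, EReal.toENNReal_top, eq_comm, iSup_eq_top]
    intro b hb
    obtain ⟨k, hk⟩ := ENNReal.exists_nat_gt hb.ne
    refine ⟨k * n, hk.trans_le ?_⟩
    rw [truncEdge_eq_of_forall_notMem hU, Nat.cast_mul, neg_div, neg_neg,
      mul_div_cancel_right₀ _ hn0.ne', ENNReal.ofReal_natCast]
  · rw [upperEdge_eq hn hU, ← EReal.coe_natCast, ← EReal.coe_div, ← EReal.coe_neg,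
      EReal.real_coe_toENNReal]
    apply le_antisymm
    · refine le_iSup_of_le m.natAbs (ENNReal.ofReal_le_ofReal ?_)
      rw [truncEdge_eq hm hU, max_eq_left]
      have h1 : -(m.natAbs : ℤ) ≤ m := by omega
      exact_mod_cast h1
    · refine iSup_le fun K => ENNReal.ofReal_le_ofReal ?_
      rw [truncEdge_eq hm hU]
      gcongr
      exact le_max_left _ _

lemma truncEdge_anti {n K K' : ℕ} (hK : K ≤ K') : truncEdge p n K' U ≤ truncEdge p n K U := by
  have h1 : -(K' : ℝ) ≤ -K := by
    have : (K : ℝ) ≤ K' := by exact_mod_cast hK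
    linarith
  rcases edge_cases p U n with hU | ⟨m, hm, hU⟩
  · simpa [truncEdge_eq_of_forall_notMem hU] using hK
  · rw [truncEdge_eq hm hU, truncEdge_eq hm hU]
    exact max_le_max le_rfl h1

/-- The expectation of the upper edge is the limit of the truncated ones. -/
lemma exists_integral_truncEdge_lt {n : ℕ} (hn : 1 ≤ n) {c : ℝ}
    (hc : expectation (fun U => upperEdge p U n / (n : EReal)) < (c : EReal)) :
    ∃ K : ℕ, ∫ U, truncEdge p n K U ∂law < c * n := by
  by_contra hcon
  push Not at hcon
  have hn0 : (0 : ℝ) < n := by exact_mod_cast hn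
  refine absurd hc (not_lt.2 ?_)
  set P : ENNReal := ∫⁻ U, (upperEdge p U n / (n : EReal)).toENNReal ∂law with hP
  set Q : ℕ → ENNReal := fun K => ∫⁻ U, ENNReal.ofReal (-(truncEdge p n K U / n)) ∂law with hQ
  have hPK : ∀ K, P = ∫⁻ U, ENNReal.ofReal (truncEdge p n K U / n) ∂law := fun K =>
    lintegral_congr fun U => toENNReal_upperEdge_div hn K
  have hint : ∀ K, Integrable (fun U => truncEdge p n K U / n) law := fun K =>
    (integrable_truncEdge p n K).div_const _
  have hPtop : P ≠ ⊤ := by rw [hPK 0]; exact ((hint 0).lintegral_lt_top).ne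
  have hQtop : ∀ K, Q K ≠ ⊤ := fun K => ((hint K).neg.lintegral_lt_top).ne
  have h1 : ∀ K, (Q K).toReal ≤ P.toReal - c := by
    intro K
    have h2 := integral_eq_lintegral_pos_part_sub_lintegral_neg_part (hint K)
    rw [← hPK K, integral_div] at h2
    have h3 := hcon K
    rw [← le_div_iff₀ hn0] at h3
    change _ = P.toReal - (Q K).toReal at h2
    linarith
  have h0 : 0 ≤ P.toReal - c := ENNReal.toReal_nonneg.trans (h1 0)
  have hN : ∫⁻ U, (-(upperEdge p U n / (n : EReal))).toENNReal ∂law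
      ≤ ENNReal.ofReal (P.toReal - c) := by
    simp only [toENNReal_neg_upperEdge_div hn]
    rw [lintegral_iSup]
    · refine iSup_le fun K => ?_
      change Q K ≤ _
      rw [← ENNReal.ofReal_toReal (hQtop K)]
      exact ENNReal.ofReal_le_ofReal (h1 K)
    · exact fun K => ((measurable_truncEdge p n K).div_const _).neg.ennreal_ofReal
    · intro K K' hK U
      refine ENNReal.ofReal_le_ofReal (neg_le_neg ?_)
      gcongr
      exact truncEdge_anti hK
  unfold expectation
  refine le_trans ?_ (EReal.sub_le_sub le_rfl (EReal.coe_ennreal_le_coe_ennreal_iff.2 hN))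
  rw [← hP, ← EReal.coe_ennreal_toReal hPtop, EReal.coe_ennreal_ofReal, max_eq_left h0,
    ← EReal.coe_sub]
  simp

lemma exists_integral_truncEdge_lt_of_edgeSpeed_lt {c : ℝ} (hc : edgeSpeed p < (c : EReal)) :
    ∃ n, 1 ≤ n ∧ ∃ K : ℕ, ∫ U, truncEdge p n K U ∂law < c * n := by
  unfold edgeSpeed at hc
  simp only [iInf_lt_iff] at hc
  obtain ⟨n, hn, h⟩ := hc
  exact ⟨n, hn, exists_integral_truncEdge_lt hn h⟩

lemma edgeSpeed_le_integral_truncEdge {n : ℕ} (hn : 1 ≤ n) (K : ℕ) :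
    edgeSpeed p ≤ (((∫ U, truncEdge p n K U ∂law) / n : ℝ) : EReal) :=
  edgeSpeed_le hn (integrable_truncEdge p n K) fun _ _ hx => le_truncEdge_of_mem hx

lemma edgeSpeed_le_one (p : ℝ) : edgeSpeed p ≤ 1 := by
  have h := edgeSpeed_le (p := p) (n := 1) le_rfl (integrable_const (1 : ℝ))
    fun U x hx => by exact_mod_cast le_of_mem_edgeGE hx
  simpa using h

lemma edgeSpeed_mono (hp : p ≤ p') : edgeSpeed p ≤ edgeSpeed p' := by
  refine iInf₂_mono fun n hn => expectation_mono fun U => ?_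
  refine EReal.div_le_div_right_of_nonneg (by exact_mod_cast Nat.zero_le n) ?_
  refine iSup₂_le fun x hx => ?_
  obtain ⟨y, hy, hxy⟩ := exists_mem_reached hn
    (edgeGE_mono hp le_rfl (mem_edgeGE_of_mem_reached hx))
  refine le_trans ?_ (le_iSup₂_of_le y hy le_rfl)
  exact_mod_cast hxy

/-! ### Subadditivity and the upper tail of the edge -/

/-- The upper edge at level `n` is equal to `j`. -/
def edgeEQ (p : ℝ) (n : ℕ) (j : ℤ) : Set Labels := edgeGE p n j \ edgeGE p n (j + 1)

lemma measurableSet_edgeEQ (p : ℝ) (n : ℕ) (j : ℤ) : MeasurableSet (edgeEQ p n j) :=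
  (measurableSet_edgeGE p n j).diff (measurableSet_edgeGE p n (j + 1))

lemma even_of_mem_edgeEQ {n : ℕ} (hn : 1 ≤ n) {j : ℤ} (hU : U ∈ edgeEQ p n j) :
    Even ((n : ℤ) + j) := by
  obtain ⟨h, h1, h2, h3, h4⟩ := exists_even_end hn hU.1
  have h5 : ¬ j + 1 ≤ h n := fun h5 => hU.2 ⟨h, h1, h2, h5⟩
  rwa [show j = h n by omega]

/-- Decompose by the edge value `j` at level `n`. Every path crosses column `n` at height at most
`j`, and its continuation only reads columns from `n` on, hence is independent of `j` and
distributed as the edge seen from `(n, j)`. -/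
lemma law_edgeGE_add_le {n : ℕ} (hn : 1 ≤ n) (r : ℕ) (x : ℤ) :
    law (edgeGE p (n + r) x) ≤ ∑' j : ℤ, law (edgeEQ p n j) * law (edgeGE p r (x - j)) := by
  let B : ℤ → Set Labels := fun j =>
    pathEvent p n (n + r) fun h => h n ≤ j ∧ x ≤ h (n + r)
  have h1 : edgeGE p (n + r) x ⊆ ⋃ j, edgeEQ p n j ∩ B j := by
    rintro U ⟨h, h1, h2, h3⟩
    have h4 : U ∈ edgeGE p n (h n) := ⟨h, h1.sub le_rfl (by omega), h2, le_rfl⟩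
    rcases edge_cases p U n with hU | ⟨m, -, hU⟩
    · exact absurd h4 (hU _)
    · refine Set.mem_iUnion.2 ⟨m, ⟨(hU m).2 le_rfl, fun h5 => ?_⟩,
        h, h1.sub (Nat.zero_le n) le_rfl, (hU _).1 h4, h3⟩
      have := (hU _).1 h5
      omega
  refine (measure_mono h1).trans ((measure_iUnion_le _).trans (ENNReal.tsum_le_tsum fun j => ?_))
  by_cases hev : Even ((n : ℤ) + j)
  · have hS : ∀ y, MeasurableSet[sigma {z : Site | z.1.1 < n}] (edgeGE p n y) := fun y =>
      measurableSet_pathEvent_sigma (isLocal_edge n y) fun h _ k _ hk hev => by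
        simpa [siteAt] using hk
    have hT : MeasurableSet[sigma {z : Site | (n : ℤ) ≤ z.1.1}] (B j) := by
      refine measurableSet_pathEvent_sigma ?_ fun h _ k hk _ hev => by simpa [siteAt] using hk
      intro f g hfg hf
      rwa [← hfg n le_rfl (by omega), ← hfg (n + r) (by omega) le_rfl]
    have hdisj : Disjoint {z : Site | z.1.1 < n} {z : Site | (n : ℤ) ≤ z.1.1} :=
      Set.disjoint_left.2 fun z (h1 : z.1.1 < n) (h2 : (n : ℤ) ≤ z.1.1) =>
        absurd h1 (not_lt.2 h2)
    have hE : MeasurableSet[sigma {z : Site | z.1.1 < n}] (edgeEQ p n j) :=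
      @MeasurableSet.diff _ (sigma _) _ _ (hS j) (hS (j + 1))
    rw [law_inter_of_disjoint hdisj hE hT]
    refine mul_le_mul_right ?_ _
    rw [← (measurePreserving_shift n j hev).measure_preimage
      (measurableSet_edgeGE p r (x - j)).nullMeasurableSet]
    refine measure_mono ?_
    rintro U ⟨h, h1, h2, h3⟩
    refine ⟨fun k => h (k + n) - j, IsPath.to_shift hev ?_, ?_, ?_⟩
    · rwa [zero_add, add_comm r n]
    · simpa using h2
    · rw [add_comm n r] at h3
      dsimp only
      omega
  · have h2 : edgeEQ p n j = ∅ := by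
      ext U
      simpa using fun hU => hev (even_of_mem_edgeEQ hn hU)
    simp [h2]

/-- Chernoff bound for the subadditive edge: each block of `n` columns contributes one exponential
moment. The remaining `r` columns use only that the edge rises by at most 1 per column. -/
lemma law_edgeGE_mul_add_le {n : ℕ} (hn : 1 ≤ n) {θ : ℝ} (hθ : 0 ≤ θ) (k r : ℕ) (x : ℤ) :
    law (edgeGE p (k * n + r) x) ≤
      (∑' j : ℤ, law (edgeEQ p n j) * ENNReal.ofReal (Real.exp (θ * j))) ^ k *
        ENNReal.ofReal (Real.exp (θ * (r - x))) := by
  induction k generalizing x with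
  | zero =>
    rw [pow_zero, one_mul, zero_mul, zero_add]
    by_cases hx : x ≤ r
    · refine prob_le_one.trans ?_
      rw [← ENNReal.ofReal_one]
      refine ENNReal.ofReal_le_ofReal (Real.one_le_exp (mul_nonneg hθ ?_))
      have : (x : ℝ) ≤ r := by exact_mod_cast hx
      linarith
    · have h1 : edgeGE p r x = ∅ := by
        ext U
        simpa using fun hU => hx (le_of_mem_edgeGE hU)
      simp [h1]
  | succ k ih =>
    rw [show (k + 1) * n + r = n + (k * n + r) by ring, pow_succ, mul_comm (_ ^ k), mul_assoc,
      ← ENNReal.tsum_mul_right]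
    refine (law_edgeGE_add_le hn _ x).trans (ENNReal.tsum_le_tsum fun j => ?_)
    rw [mul_assoc]
    refine mul_le_mul_right ((ih (x - j)).trans_eq ?_) _
    rw [mul_left_comm, ← ENNReal.ofReal_mul (Real.exp_pos _).le, ← Real.exp_add]
    congr 3
    push_cast
    ring

/-- The value `-∞` contributes nothing on the left, and truncation from below only increases the
exponential. -/
lemma tsum_edgeEQ_le (p : ℝ) (n K : ℕ) {θ : ℝ} (hθ : 0 ≤ θ) :
    ∑' j : ℤ, law (edgeEQ p n j) * ENNReal.ofReal (Real.exp (θ * j)) ≤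
      ∫⁻ U, ENNReal.ofReal (Real.exp (θ * truncEdge p n K U)) ∂law := by
  have h1 : ∀ j : ℤ, law (edgeEQ p n j) * ENNReal.ofReal (Real.exp (θ * j)) =
      ∫⁻ U, (edgeEQ p n j).indicator (fun _ => ENNReal.ofReal (Real.exp (θ * j))) U ∂law := by
    intro j
    rw [lintegral_indicator_const (measurableSet_edgeEQ p n j), mul_comm]
  simp_rw [h1]
  rw [← lintegral_tsum fun j =>
    (measurable_const.indicator (measurableSet_edgeEQ p n j)).aemeasurable]
  refine lintegral_mono fun U => ?_
  rcases edge_cases p U n with hU | ⟨m, hm, hU⟩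
  · rw [ENNReal.tsum_eq_zero.2 fun j => Set.indicator_of_notMem (fun h => hU j h.1) _]
    exact zero_le
  · rw [tsum_eq_single m fun j hj => Set.indicator_of_notMem (fun h => hj ?_) _]
    · rw [Set.indicator_of_mem]
      · refine ENNReal.ofReal_le_ofReal (Real.exp_le_exp.2 (mul_le_mul_of_nonneg_left ?_ hθ))
        exact le_truncEdge_of_mem ((hU m).2 le_rfl)
      · exact ⟨(hU m).2 le_rfl, fun h => by have := (hU _).1 h; omega⟩
    · have h2 := (hU j).1 h.1
      have h3 := h.2
      rw [hU] at h3
      omega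

/-- A bounded variable with negative mean has an exponential moment below one. -/
lemma exists_integral_exp_lt_one {X : Labels → ℝ} (hX : Measurable X) {B : ℝ}
    (hB : ∀ U, |X U| ≤ B) (hneg : ∫ U, X U ∂law < 0) :
    ∃ θ : ℝ, 0 < θ ∧ ∫ U, Real.exp (θ * X U) ∂law < 1 := by
  set c := -∫ U, X U ∂law with hc
  have hc0 : 0 < c := by linarith
  set A := max B 1 with hA
  have hA1 : 1 ≤ A := le_max_right _ _
  have hA0 : 0 < A := by linarith
  have hBA : ∀ U, |X U| ≤ A := fun U => (hB U).trans (le_max_left _ _)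
  have hint : Integrable X law := integrable_of_bounds hX (fun U => (abs_le.1 (hBA U)).1)
    fun U => (abs_le.1 (hBA U)).2
  -- The first bound keeps θX in [-1, 1], where exp t ≤ 1 + t + t²; the second makes the quadratic
  -- term at most half of the linear gain θc.
  refine ⟨min (1 / A) (c / (2 * A ^ 2)), by positivity, ?_⟩
  set θ := min (1 / A) (c / (2 * A ^ 2)) with hθ
  have hθ0 : 0 < θ := by positivity
  have h1 : θ * A ≤ 1 := by
    have := min_le_left (1 / A) (c / (2 * A ^ 2))
    rwa [le_div_iff₀ hA0] at this
  have h2 : θ * (2 * A ^ 2) ≤ c := by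
    have := min_le_right (1 / A) (c / (2 * A ^ 2))
    rwa [le_div_iff₀ (by positivity)] at this
  have h3 : ∀ U, Real.exp (θ * X U) ≤ 1 + θ * X U + θ ^ 2 * A ^ 2 := by
    intro U
    have h4 : |θ * X U| ≤ θ * A := by
      rw [abs_mul, abs_of_pos hθ0]
      exact mul_le_mul_of_nonneg_left (hBA U) hθ0.le
    have h5 := (abs_le.1 (Real.abs_exp_sub_one_sub_id_le (h4.trans h1))).2
    have h6 : (θ * X U) ^ 2 ≤ (θ * A) ^ 2 := sq_le_sq' (abs_le.1 h4).1 (abs_le.1 h4).2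
    nlinarith
  have hintexp : Integrable (fun U => Real.exp (θ * X U)) law :=
    integrable_of_bounds (A := 0) (B := Real.exp 1) (by fun_prop) (fun U => (Real.exp_pos _).le)
      fun U => Real.exp_le_exp.2 (le_trans (mul_le_mul_of_nonneg_left
        ((le_abs_self _).trans (hBA U)) hθ0.le) h1)
  have hlin : Integrable (fun U => 1 + θ * X U) law :=
    (integrable_const 1).add (hint.const_mul θ)
  have h4 := integral_mono hintexp (hlin.add (integrable_const (θ ^ 2 * A ^ 2))) h3
  rw [integral_add' hlin (integrable_const _),
    integral_add (integrable_const 1) (hint.const_mul θ), integral_const_mul] at h4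
  simp only [integral_const, probReal_univ, one_smul] at h4
  refine lt_of_le_of_lt h4 ?_
  have h5 : ∫ U, X U ∂law = -c := by rw [hc, neg_neg]
  rw [h5]
  nlinarith

/-- Above the edge speed, the upper tail of the edge vanishes. -/
lemma tendsto_edgeGE_of_edgeSpeed_lt {b : ℝ} (hb : edgeSpeed p < (b : EReal)) :
    Filter.Tendsto (fun m : ℕ => law.real (edgeGE p m ⌈b * m⌉)) Filter.atTop (nhds 0) := by
  obtain ⟨n, hn, K, hK⟩ := exists_integral_truncEdge_lt_of_edgeSpeed_lt hb
  have hn0 : (0 : ℝ) < n := by exact_mod_cast hn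
  obtain ⟨θ, hθ, hlt⟩ := exists_integral_exp_lt_one
    (X := fun U => truncEdge p n K U - b * n) ((measurable_truncEdge p n K).sub_const _)
    (B := K + n + |b * n|) (by
      intro U
      have h1 := neg_le_truncEdge (p := p) (n := n) (K := K) (U := U)
      have h2 := truncEdge_le (p := p) (n := n) (K := K) (U := U)
      have h3 := abs_le.1 (le_refl |b * n|)
      have h4 : (0 : ℝ) ≤ K := Nat.cast_nonneg K
      rw [abs_le]
      constructor <;> linarith [h3.1, h3.2])
    (by
      rw [integral_sub (integrable_truncEdge p n K) (integrable_const _)]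
      simpa using hK)
  set ρ := ∫ U, Real.exp (θ * (truncEdge p n K U - b * n)) ∂law with hρ
  have hρ0 : 0 ≤ ρ := integral_nonneg fun U => (Real.exp_pos _).le
  have hexp : ∫⁻ U, ENNReal.ofReal (Real.exp (θ * truncEdge p n K U)) ∂law =
      ENNReal.ofReal (ρ * Real.exp (θ * (b * n))) := by
    rw [hρ, ← integral_mul_const, ← ofReal_integral_eq_lintegral_ofReal]
    · congr 2
      funext U
      rw [← Real.exp_add]
      congr 1
      ring
    · refine integrable_of_bounds (A := 0) (B := Real.exp (θ * n)) ?_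
        (fun U => (Real.exp_pos _).le)
        fun U => Real.exp_le_exp.2 (mul_le_mul_of_nonneg_left truncEdge_le hθ.le)
      exact Real.measurable_exp.comp ((measurable_truncEdge p n K).const_mul θ)
    · exact Filter.Eventually.of_forall fun U => (Real.exp_pos _).le
  have hbound : ∀ m : ℕ, law.real (edgeGE p m ⌈b * m⌉) ≤
      ρ ^ (m / n) * Real.exp (θ * (n * (1 + |b|))) := by
    intro m
    have hm : m / n * n + m % n = m := Nat.div_add_mod' m n
    have h1 := law_edgeGE_mul_add_le (p := p) hn hθ.le (m / n) (m % n) ⌈b * m⌉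
    rw [hm] at h1
    have h2 := h1.trans (mul_le_mul_left
      (pow_le_pow_left' ((tsum_edgeEQ_le p n K hθ.le).trans_eq hexp) (m / n)) _)
    rw [← ENNReal.ofReal_pow (by positivity), ← ENNReal.ofReal_mul (by positivity)] at h2
    refine (ENNReal.toReal_le_of_le_ofReal (by positivity) h2).trans ?_
    rw [mul_pow, mul_assoc, ← Real.exp_nat_mul, ← Real.exp_add]
    refine mul_le_mul_of_nonneg_left (Real.exp_le_exp.2 ?_) (by positivity)
    have h3 : b * m ≤ ⌈b * m⌉ := Int.le_ceil _
    have h4 : (m : ℝ) = (m / n : ℕ) * n + (m % n : ℕ) := by exact_mod_cast hm.symm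
    have h5 : ((m % n : ℕ) : ℝ) ≤ n := by exact_mod_cast (Nat.mod_lt m hn).le
    have h6 : (0 : ℝ) ≤ (m % n : ℕ) := Nat.cast_nonneg _
    have h7 : ((m / n : ℕ) : ℝ) * (b * n) + ((m % n : ℕ) - ⌈b * m⌉) ≤ n * (1 + |b|) := by
      have h8 : -|b| ≤ b := neg_abs_le b
      have h9 : ((m / n : ℕ) : ℝ) * (b * n) = b * m - b * (m % n : ℕ) := by
        linear_combination (-b) * h4
      nlinarith [abs_nonneg b]
    calc _ = θ * (((m / n : ℕ) : ℝ) * (b * n) + ((m % n : ℕ) - ⌈b * m⌉)) := by ring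
      _ ≤ _ := mul_le_mul_of_nonneg_left h7 hθ.le
  have hlim : Filter.Tendsto (fun m : ℕ => ρ ^ (m / n) * Real.exp (θ * (n * (1 + |b|))))
      Filter.atTop (nhds 0) := by
    have h1 := (tendsto_pow_atTop_nhds_zero_of_lt_one hρ0 hlt).comp
      (Nat.tendsto_div_const_atTop (show n ≠ 0 by omega))
    simpa using h1.mul_const (Real.exp (θ * (n * (1 + |b|))))
  exact squeeze_zero (fun m => measureReal_nonneg) hbound hlim

/-! ### Percolation -/

/-- Sites of the cluster in finitely many columns lie in a finite box. Conversely, of two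
consecutive columns a path passes at most one in mid-arrow, so `N + 2` columns force a site beyond
column `N`. -/
lemma infinite_cluster_iff :
    (cluster p U).Infinite ↔ ∀ n, ∃ h, IsPath p U h 0 n ∧ h 0 = 0 := by
  constructor
  · intro hinf n
    by_contra hno
    push Not at hno
    refine hinf (Set.Finite.subset (Set.Finite.preimage Subtype.val_injective.injOn
      (Set.finite_Icc ((0 : ℤ), -(n : ℤ)) ((n : ℤ), (n : ℤ)))) ?_)
    intro b hb
    obtain ⟨-, h, hp, h0, h1⟩ := isPath_of_connected hb
    replace h0 : h 0 = 0 := h0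
    replace hp : IsPath p U h 0 b.1.1.toNat := hp
    have hb0 := b.2.2
    have hn : b.1.1.toNat < n := by
      by_contra hle
      exact hno h (hp.sub le_rfl (not_lt.1 hle)) h0
    have h2 := hp.dist le_rfl (Nat.zero_le _) le_rfl
    rw [h0, h1, abs_le] at h2
    refine ⟨⟨hb0, ?_⟩, ?_, ?_⟩ <;> simp only <;> push_cast at h2 <;> omega
  · intro hall hfin
    obtain ⟨N, hN⟩ := (hfin.image fun b : Site => b.1.1.toNat).bddAbove
    have hcol : ∀ b ∈ cluster p U, b.1.1.toNat ≤ N := fun b hb => hN ⟨b, hb, rfl⟩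
    obtain ⟨h, hp, h0⟩ := hall (N + 2)
    have hev0 : Even (((0 : ℕ) : ℤ) + h 0) := by simp [h0]
    have key : ∀ m, N < m → m ≤ N + 2 → ¬ Even ((m : ℤ) + h m) := by
      intro m hm hm' hev
      have h1 := (hp.sub le_rfl hm').connected (Nat.zero_le m) hev0 hev
      have h2 : siteAt 0 (h 0) hev0 = origin := by
        simp [siteAt, origin, h0]
      rw [h2] at h1
      have h3 := hcol _ h1
      simp only [siteAt, Int.toNat_natCast] at h3
      omega
    have h1 := key (N + 1) (by omega) (by omega)
    have h2 := key (N + 2) (by omega) le_rfl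
    rcases hp (N + 1) (by omega) (by omega) with h3 | h3
    · exact h1 h3.1.even
    · rw [h3.2] at h2
      rw [Int.even_iff] at h1 h2
      push_cast at h1 h2
      omega

lemma percolationProb_mono (hp : p ≤ p') : percolationProb p ≤ percolationProb p' := by
  refine measure_mono fun U hU => ?_
  rw [Set.mem_ofPred_eq, infinite_cluster_iff] at hU ⊢
  intro n
  obtain ⟨h, h1, h2⟩ := hU n
  exact ⟨h, h1.mono hp, h2⟩

lemma pos_of_percolationProb_pos (h : 0 < percolationProb p) : 0 < p := by
  by_contra hp
  refine h.ne' ?_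
  have h1 : {U | (cluster p U).Infinite} = ∅ := by
    ext U
    rw [Set.mem_ofPred_eq, infinite_cluster_iff]
    simp only [Set.mem_empty_iff_false, iff_false]
    intro h2
    obtain ⟨h, h3, h4⟩ := h2 1
    rcases h3 0 le_rfl one_pos with h5 | h5
    · obtain ⟨⟨_, h6⟩, _⟩ := h5
      have h7 : (U _ : ℝ) < p := h6
      have h8 := (U ⟨(((0 : ℕ) : ℤ), h 0), ‹_›⟩).2.1
      linarith
    · simp [h4] at h5
  rw [percolationProb, h1, measure_empty]

/-- An infinite cluster yields, at every level, a path from the origin ending at height ≥ 0 or ≤ 0.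
By reflection its probability is at most twice that of a nonnegative edge, which tends to 0 if the
speed is negative. -/
lemma edgeSpeed_nonneg_of_percolationProb_pos (h : 0 < percolationProb p) : 0 ≤ edgeSpeed p := by
  by_contra hneg
  rw [not_le] at hneg
  have h1 := tendsto_edgeGE_of_edgeSpeed_lt (p := p) (b := 0) (by simpa using hneg)
  have h2 : ∀ m : ℕ, law.real {U | (cluster p U).Infinite} ≤
      2 * law.real (edgeGE p m ⌈0 * (m : ℝ)⌉) := by
    intro m
    have h3 : {U | (cluster p U).Infinite} ⊆
        edgeGE p m ⌈0 * (m : ℝ)⌉ ∪ mirror ⁻¹' edgeGE p m ⌈0 * (m : ℝ)⌉ := by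
      intro U hU
      rw [Set.mem_ofPred_eq, infinite_cluster_iff] at hU
      obtain ⟨h, h4, h5⟩ := hU m
      simp only [zero_mul, Int.ceil_zero]
      rcases le_total 0 (h m) with h6 | h6
      · exact Or.inl ⟨h, h4, h5.le, h6⟩
      · refine Or.inr ⟨fun n => -h n, IsPath.of_mirror ?_, by simp [h5], by simpa using h6⟩
        rwa [mirror_mirror]
    refine (measureReal_mono h3).trans ((measureReal_union_le _ _).trans_eq ?_)
    rw [measureReal_mirror_preimage (measurableSet_edgeGE _ _ _)]
    ring
  have h3 := ge_of_tendsto' (h1.const_mul 2) h2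
  rw [mul_zero] at h3
  have h4 : law.real {U | (cluster p U).Infinite} = 0 := le_antisymm h3 measureReal_nonneg
  rw [measureReal_eq_zero_iff] at h4
  exact ne_of_gt h h4

/-! ### Dependence on the parameter -/

lemma ae_label_ne (p : ℝ) : ∀ᵐ U ∂law, ∀ z : Site, (U z : ℝ) ≠ p := by
  rw [ae_all_iff]
  intro z
  have h1 : MeasurePreserving (fun U : Labels => U z) law (volume : Measure unitInterval) :=
    measurePreserving_eval_infinitePi (fun _ : Site => (volume : Measure unitInterval)) z
  have h2 : (volume : Measure unitInterval) {x | (x : ℝ) = p} = 0 :=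
    Set.Subsingleton.measure_zero (fun x hx y hy => Subtype.ext (hx.trans hy.symm)) _
  have h3 := h1.measure_preimage (s := {x | (x : ℝ) = p})
    (measurableSet_eq_fun measurable_subtype_coe measurable_const).nullMeasurableSet
  rw [h2] at h3
  rw [ae_iff]
  simpa using h3

/-- A given path uses finitely many labels, all strictly below `p`, so it is already open slightly
below `p`. -/
lemma tendsto_pathEvent_left {C : (ℕ → ℤ) → Prop} :
    Filter.Tendsto (fun k : ℕ => law.real (pathEvent (p - 1 / ((k : ℝ) + 1)) s e C)) Filter.atTop
      (nhds (law.real (pathEvent p s e C))) := by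
  have hmono : Monotone fun k : ℕ => pathEvent (p - 1 / ((k : ℝ) + 1)) s e C := by
    intro k l hkl
    exact pathEvent_mono (sub_le_sub_left (Nat.one_div_le_one_div hkl) p) fun _ h => h
  have hU : pathEvent p s e C = ⋃ k : ℕ, pathEvent (p - 1 / ((k : ℝ) + 1)) s e C := by
    apply Set.Subset.antisymm
    · rintro U ⟨h, h1, h2⟩
      have h3 : ∀ n ∈ Finset.Ico s e, ∀ᶠ k : ℕ in Filter.atTop,
          (Open (p - 1 / ((k : ℝ) + 1)) U n (h n) ∧ |h (n + 1) - h n| ≤ 1) ∨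
            (¬ Even ((n : ℤ) + h n) ∧ h (n + 1) = h n) := by
        intro n hn
        rw [Finset.mem_Ico] at hn
        rcases h1 n hn.1 hn.2 with ⟨⟨h4, h5⟩, h6⟩ | h4
        · have h7 : Filter.Tendsto (fun k : ℕ => p - 1 / ((k : ℝ) + 1)) Filter.atTop (nhds p) := by
            simpa using tendsto_one_div_add_atTop_nhds_zero_nat.const_sub p
          filter_upwards [h7.eventually (lt_mem_nhds h5)] with k hk
          exact Or.inl ⟨⟨h4, hk⟩, h6⟩
        · exact Filter.Eventually.of_forall fun _ => Or.inr h4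
      obtain ⟨k, hk⟩ := ((Finset.Ico s e).eventually_all.2 h3).exists
      exact Set.mem_iUnion.2 ⟨k, h, fun n hn hn' => hk n (Finset.mem_Ico.2 ⟨hn, hn'⟩), h2⟩
    · refine Set.iUnion_subset fun k => pathEvent_mono ?_ fun _ h => h
      have : (0 : ℝ) ≤ 1 / ((k : ℝ) + 1) := by positivity
      linarith
  rw [hU]
  exact (ENNReal.tendsto_toReal (measure_ne_top _ _)).comp (tendsto_measure_iUnion_atTop hmono)

/-- Only finitely many sites are relevant, and almost surely none of their labels equals `p`; so no
relevant site opens when `p` is raised slightly. -/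
lemma tendsto_edgeGE_right (p : ℝ) (n : ℕ) (x : ℤ) :
    Filter.Tendsto (fun k : ℕ => law.real (edgeGE (p + 1 / ((k : ℝ) + 1)) n x)) Filter.atTop
      (nhds (law.real (edgeGE p n x))) := by
  have hanti : Antitone fun k : ℕ => edgeGE (p + 1 / ((k : ℝ) + 1)) n x := by
    intro k l hkl
    exact edgeGE_mono (add_le_add_right (Nat.one_div_le_one_div hkl) p) le_rfl
  have hlim : Filter.Tendsto (fun k : ℕ => p + 1 / ((k : ℝ) + 1)) Filter.atTop (nhds p) := by
    simpa using tendsto_one_div_add_atTop_nhds_zero_nat.const_add p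
  have hle : ∀ k : ℕ, p ≤ p + 1 / ((k : ℝ) + 1) := fun k => by
    have : (0 : ℝ) ≤ 1 / ((k : ℝ) + 1) := by positivity
    linarith
  have hae : (⋂ k : ℕ, edgeGE (p + 1 / ((k : ℝ) + 1)) n x) =ᵐ[law] edgeGE p n x := by
    filter_upwards [ae_label_ne p] with U hU
    refine propext ⟨fun h1 => ?_, fun h1 => Set.mem_iInter.2 fun k => edgeGE_mono (hle k) le_rfl h1⟩
    have h2 : ∀ a ∈ Finset.range n ×ˢ Finset.Icc (x - n) n, ∀ᶠ k : ℕ in Filter.atTop,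
        Open (p + 1 / ((k : ℝ) + 1)) U a.1 a.2 → Open p U a.1 a.2 := by
      intro a _
      by_cases hev : Even ((a.1 : ℤ) + a.2)
      · rcases lt_or_gt_of_ne (hU (siteAt a.1 a.2 hev)) with h3 | h3
        · exact Filter.Eventually.of_forall fun k _ => ⟨⟨hev, by positivity⟩, h3⟩
        · filter_upwards [hlim.eventually (gt_mem_nhds h3)] with k hk
          rintro ⟨h4, h5⟩
          exact absurd h5 (not_lt.2 hk.le)
      · exact Filter.Eventually.of_forall fun k h3 => absurd h3.even hev
    obtain ⟨k, hk⟩ := ((Finset.range n ×ˢ Finset.Icc (x - n) n).eventually_all.2 h2).exists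
    obtain ⟨h, h3, h4, h5⟩ := Set.mem_iInter.1 h1 k
    refine ⟨h, fun m hm hm' => (h3 m hm hm').imp_left fun h6 => ⟨hk (m, h m) ?_ h6.1, h6.2⟩, h4, h5⟩
    have h7 := h3.dist le_rfl hm hm'.le
    have h8 := h3.dist hm hm'.le le_rfl
    rw [abs_le] at h7 h8
    push_cast at h7
    simp only [Finset.mem_product, Finset.mem_range, Finset.mem_Icc]
    omega
  rw [← measureReal_congr hae]
  exact (ENNReal.tendsto_toReal (measure_ne_top _ _)).comp (tendsto_measure_iInter_atTop
    (fun k => (measurableSet_edgeGE _ n x).nullMeasurableSet) hanti ⟨0, measure_ne_top _ _⟩)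

/-- The edge speed is upper semicontinuous from the right. -/
lemma exists_gt_edgeSpeed_lt {c : ℝ} (hc : edgeSpeed p < (c : EReal)) :
    ∃ p', p < p' ∧ edgeSpeed p' < (c : EReal) := by
  obtain ⟨n, hn, K, hK⟩ := exists_integral_truncEdge_lt_of_edgeSpeed_lt hc
  have hn0 : (0 : ℝ) < n := by exact_mod_cast hn
  have h1 : Filter.Tendsto (fun k : ℕ => ∫ U, truncEdge (p + 1 / ((k : ℝ) + 1)) n K U ∂law)
      Filter.atTop (nhds (∫ U, truncEdge p n K U ∂law)) := by
    simp only [integral_truncEdge]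
    exact (tendsto_finsetSum _ fun x _ => tendsto_edgeGE_right p n x).const_add _
  obtain ⟨k, hk⟩ := (h1.eventually (gt_mem_nhds hK)).exists
  refine ⟨p + 1 / ((k : ℝ) + 1), ?_, ?_⟩
  · have : (0 : ℝ) < 1 / ((k : ℝ) + 1) := by positivity
    linarith
  · refine (edgeSpeed_le_integral_truncEdge hn K).trans_lt ?_
    rw [EReal.coe_lt_coe_iff, div_lt_iff₀ hn0]
    exact hk

lemma one_le_edgeSpeed_one : 1 ≤ edgeSpeed 1 := by
  refine le_iInf₂ fun n hn => ?_
  have h1 : expectation (fun _ => ((1 : ℝ) : EReal)) = ((1 : ℝ) : EReal) := by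
    rw [expectation_coe (integrable_const _)]
    simp
  rw [← EReal.coe_one, ← h1]
  refine expectation_mono_ae ?_
  filter_upwards [ae_label_ne 1] with U hU
  have h2 : U ∈ edgeGE 1 n n := by
    refine ⟨fun k => k, fun k _ _ => Or.inl ⟨⟨⟨by simp, by positivity⟩, ?_⟩, by simp⟩, by simp,
      le_rfl⟩
    exact lt_of_le_of_ne (U _).2.2 (hU _)
  obtain ⟨y, hy, hny⟩ := exists_mem_reached hn h2
  rw [EReal.le_div_iff_mul_le (by exact_mod_cast hn) (EReal.natCast_ne_top n), EReal.coe_one,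
    one_mul]
  refine le_trans ?_ (le_iSup₂_of_le y hy le_rfl)
  exact_mod_cast hny

/-! ### Lower tail of the edge and crossings of tubes -/

lemma edge_lt_of_notMem {n : ℕ} {x : ℤ} {r : ℝ} (hx : U ∈ edgeGE p n x)
    (hr : U ∉ edgeGE p n ⌈r⌉) : (x : ℝ) < r := by
  by_contra hle
  exact hr (edgeGE_mono le_rfl (Int.ceil_le.2 (not_lt.1 hle)) hx)

/-- Below the edge speed, the lower tail of the edge vanishes. -/
lemma eventually_edgeGE_compl_le {α : ℝ} (hα : edgeSpeed p = (α : EReal)) (hα0 : 0 ≤ α) {ε κ : ℝ}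
    (hε : 0 < ε) (hκ : 0 < κ) :
    ∀ᶠ N : ℕ in Filter.atTop, law.real (edgeGE p N ⌈(α - ε) * N⌉)ᶜ ≤ κ := by
  -- With A and B the events that the edge exceeds slope α - ε and α + η, the mean of the edge is at
  -- least αN, which gives ε P(Aᶜ) ≤ η P(A) + P(B) ≤ 2η = εκ.
  set η := ε * κ / 2 with hη
  have hη0 : 0 < η := by positivity
  have h1 := tendsto_edgeGE_of_edgeSpeed_lt (p := p) (b := α + η)
    (by rw [hα, EReal.coe_lt_coe_iff]; linarith)
  filter_upwards [h1.eventually (gt_mem_nhds hη0), Filter.eventually_ge_atTop 1] with N hN hN1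
  have hN0 : (0 : ℝ) < N := by exact_mod_cast hN1
  set A := edgeGE p N ⌈(α - ε) * N⌉ with hA
  set B := edgeGE p N ⌈(α + η) * N⌉ with hB
  have hAm : MeasurableSet A := measurableSet_edgeGE _ _ _
  have hBm : MeasurableSet B := measurableSet_edgeGE _ _ _
  have hBA : B ⊆ A := edgeGE_mono le_rfl (Int.ceil_mono (by nlinarith))
  have hiA : Integrable (A.indicator fun _ => (ε + η) * N) law :=
    (integrable_const _).indicator hAm
  have hiB : Integrable (B.indicator fun _ => (N : ℝ)) law := (integrable_const _).indicator hBm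
  have hiC : Integrable (fun U => (α - ε) * N + A.indicator (fun _ => (ε + η) * N) U) law :=
    (integrable_const _).add hiA
  have h2 := edgeSpeed_le (p := p) hN1 (hiC.add hiB) (by
    intro U x hx
    simp only [Pi.add_apply]
    by_cases hUB : U ∈ B
    · rw [Set.indicator_of_mem (hBA hUB), Set.indicator_of_mem hUB]
      have h3 : (x : ℝ) ≤ N := by exact_mod_cast le_of_mem_edgeGE hx
      nlinarith
    · rw [Set.indicator_of_notMem hUB]
      by_cases hUA : U ∈ A
      · rw [Set.indicator_of_mem hUA]
        linarith [edge_lt_of_notMem hx hUB]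
      · rw [Set.indicator_of_notMem hUA]
        linarith [edge_lt_of_notMem hx hUA])
  rw [hα, EReal.coe_le_coe_iff, integral_add' hiC hiB,
    integral_add (integrable_const _) hiA, integral_indicator_const _ hAm,
    integral_indicator_const _ hBm, le_div_iff₀ hN0] at h2
  simp only [integral_const, probReal_univ, smul_eq_mul] at h2
  rw [probReal_compl_eq_one_sub hAm]
  have h3 : α * N ≤ ((α - ε) + law.real A * (ε + η) + law.real B) * N := by linarith
  have h4 := le_of_mul_le_mul_right h3 hN0
  have h5 : law.real A ≤ 1 := measureReal_le_one
  have h6 : ε * (1 - law.real A) ≤ ε * κ := by nlinarith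
  exact le_of_mul_le_mul_left h6 hε

/-- There is a path over the columns `s, …, s + L` which stays within distance `w` of the line
of slope `a` through `(s, y)`. -/
def tube (p : ℝ) (s : ℕ) (y : ℤ) (L : ℕ) (w a : ℝ) : Set Labels :=
  pathEvent p s (s + L) fun h =>
    ∀ n : ℕ, s ≤ n → n ≤ s + L → |(h n : ℝ) - (y + a * ((n : ℝ) - s))| ≤ w

lemma isLocal_tube (s : ℕ) (y : ℤ) (L : ℕ) (w a : ℝ) : IsLocal s (s + L) fun h =>
    ∀ n : ℕ, s ≤ n → n ≤ s + L → |(h n : ℝ) - (y + a * ((n : ℝ) - s))| ≤ w := by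
  intro f g hfg hf n hn hn'
  rw [← hfg n hn hn']
  exact hf n hn hn'

lemma measurableSet_tube (p : ℝ) (s : ℕ) (y : ℤ) (L : ℕ) (w a : ℝ) :
    MeasurableSet (tube p s y L w a) := measurableSet_pathEvent (isLocal_tube s y L w a)

lemma tube_compl_le {y : ℤ} (hy : Even ((s : ℤ) + y)) (L : ℕ) (w a : ℝ) :
    law.real (tube p s y L w a)ᶜ ≤ law.real (tube p 0 0 L w a)ᶜ := by
  rw [← measureReal_shift_preimage hy (measurableSet_tube p 0 0 L w a).compl]
  refine measureReal_mono (Set.compl_subset_compl.2 ?_)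
  rintro U ⟨h, h1, h2⟩
  refine ⟨fun n => h (n - s) + y, ?_, ?_⟩
  · have := IsPath.of_shift hy h1
    rwa [zero_add, zero_add, add_comm L s] at this
  · intro n hn hn'
    have h3 := h2 (n - s) (Nat.zero_le _) (by omega)
    rw [Nat.cast_sub hn] at h3
    push_cast at h3 ⊢
    convert h3 using 2
    ring

lemma tube_neg_compl_le {y : ℤ} (hy : Even ((s : ℤ) + y)) (L : ℕ) (w a : ℝ) :
    law.real (tube p s y L w (-a))ᶜ ≤ law.real (tube p 0 0 L w a)ᶜ := by
  refine (tube_compl_le hy L w (-a)).trans ?_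
  rw [← measureReal_mirror_preimage (measurableSet_tube p 0 0 L w a).compl]
  refine measureReal_mono (Set.compl_subset_compl.2 ?_)
  rintro U ⟨h, h1, h2⟩
  refine ⟨fun n => -h n, h1.of_mirror, fun n hn hn' => ?_⟩
  have h3 := h2 n hn hn'
  rw [← abs_neg]
  push_cast at h3 ⊢
  convert h3 using 2
  ring

/-- A tube of at least twice the width contains two disjoint tubes. -/
lemma tube_double {L : ℕ} {w a : ℝ} (hw : 0 ≤ w) :
    law.real (tube p 0 0 L (2 * w + 2) a)ᶜ ≤ law.real (tube p 0 0 L w a)ᶜ ^ 2 := by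
  -- The even integer in (w, w + 2]: even so that both shifted tubes start at lattice sites, above
  -- `w` so that they are disjoint, at most w + 2 so that both fit.
  set Y : ℤ := 2 * (⌊w / 2⌋ + 1) with hY
  have hYr : (Y : ℝ) = 2 * (⌊w / 2⌋ + 1) := by rw [hY]; push_cast; ring
  have hY1 : w < Y := by rw [hYr]; linarith [Int.lt_floor_add_one (w / 2)]
  have hY2 : (Y : ℝ) ≤ w + 2 := by rw [hYr]; linarith [Int.floor_le (w / 2)]
  have hYe : Even Y := even_two_mul _
  have hsub : ∀ y : ℤ, |(y : ℝ)| ≤ w + 2 → tube p 0 y L w a ⊆ tube p 0 0 L (2 * w + 2) a := by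
    intro y hy
    refine pathEvent_mono le_rfl fun h h1 n hn hn' => ?_
    have h2 := h1 n hn hn'
    rw [abs_le] at h2 hy ⊢
    push_cast at h2 ⊢
    constructor <;> linarith [h2.1, h2.2, hy.1, hy.2]
  let S : ℤ → Set Site := fun y => {z | |(z.1.2 : ℝ) - (y + a * z.1.1)| ≤ w}
  have hS : ∀ y : ℤ, MeasurableSet[sigma (S y)] (tube p 0 y L w a)ᶜ := by
    intro y
    refine @MeasurableSet.compl _ _ (sigma (S y))
      (measurableSet_pathEvent_sigma (isLocal_tube 0 y L w a) fun h h1 n hn hn' hev => ?_)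
    have h2 := h1 n hn hn'.le
    simpa [S, siteAt] using h2
  have hdisj : Disjoint (S Y) (S (-Y)) := by
    refine Set.disjoint_left.2 fun z h1 h2 => ?_
    change |_| ≤ w at h1
    change |_| ≤ w at h2
    rw [abs_le] at h1 h2
    push_cast at h2
    linarith [h1.1, h2.2]
  have h1 : (tube p 0 0 L (2 * w + 2) a)ᶜ ⊆ (tube p 0 Y L w a)ᶜ ∩ (tube p 0 (-Y) L w a)ᶜ := by
    refine Set.subset_inter (Set.compl_subset_compl.2 (hsub _ ?_))
      (Set.compl_subset_compl.2 (hsub _ ?_))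
    · rw [abs_of_nonneg (by linarith)]; exact hY2
    · push_cast
      rw [abs_neg, abs_of_nonneg (by linarith)]; exact hY2
  refine (measureReal_mono h1).trans ?_
  rw [measureReal_def, law_inter_of_disjoint hdisj (hS Y) (hS (-Y)), ENNReal.toReal_mul, sq]
  exact mul_le_mul (tube_compl_le (by simpa using hYe) L w a)
    (tube_compl_le (by simpa using hYe.neg) L w a) ENNReal.toReal_nonneg measureReal_nonneg

/-- Long tubes of positive relative width along the edge speed are crossed. -/
lemma exists_tube_compl_le {α : ℝ} (hα : edgeSpeed p = (α : EReal)) (hα0 : 0 ≤ α) {δ κ : ℝ}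
    (hδ : 0 < δ) (hκ : 0 < κ) (l : ℕ) :
    ∃ ℓ : ℕ, l ≤ ℓ ∧ law.real (tube p 0 0 (2 * ℓ) (δ * ℓ) α)ᶜ ≤ κ := by
  have hα1 : α ≤ 1 := by
    have := edgeSpeed_le_one p
    rw [hα] at this
    exact_mod_cast this
  -- With half-length Jn and N = 2Jn, the allowed width is 6εN. The choice of `J` makes the grid
  -- spacing `n` at most εN/2, so control at grid columns and the bound 1 on steps suffice.
  set ε := δ / 12 with hε
  have hε0 : 0 < ε := by positivity
  obtain ⟨J, hJ⟩ := exists_nat_gt (1 / ε)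
  have hJ0 : 0 < J := by
    have : (0 : ℝ) < J := lt_trans (by positivity) hJ
    exact_mod_cast this
  have hJε : 1 ≤ ε * J := by
    rw [div_lt_iff₀ hε0] at hJ
    linarith
  set κ' := κ / (8 * J) with hκ'
  have hJr : (0 : ℝ) < J := by exact_mod_cast hJ0
  have hκ'0 : 0 < κ' := by positivity
  have hup := tendsto_edgeGE_of_edgeSpeed_lt (p := p) (b := α + ε)
    (by rw [hα, EReal.coe_lt_coe_iff]; linarith)
  have hmul : ∀ j, 0 < j → Filter.Tendsto (fun n : ℕ => j * n) Filter.atTop Filter.atTop :=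
    fun j hj => Filter.tendsto_id.const_mul_atTop' hj
  have hev1 : ∀ᶠ n : ℕ in Filter.atTop, ∀ j ∈ Finset.Icc 1 (2 * J),
      law.real (edgeGE p (j * n) ⌈(α + ε) * (j * n : ℕ)⌉) < κ' := by
    rw [Finset.eventually_all]
    intro j hj
    exact (hup.comp (hmul j (Finset.mem_Icc.1 hj).1)).eventually (gt_mem_nhds hκ'0)
  have hev2 := (hmul (2 * J) (by omega)).eventually
    (eventually_edgeGE_compl_le hα hα0 hε0 (half_pos hκ))
  obtain ⟨n₁, hn₁⟩ := exists_nat_gt (1 / ε)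
  obtain ⟨n, hn1, hn2, hnl, hnn, hn0⟩ := (hev1.and (hev2.and ((Filter.eventually_ge_atTop l).and
    ((Filter.eventually_ge_atTop n₁).and (Filter.eventually_ge_atTop 1))))).exists
  refine ⟨J * n, hnl.trans (Nat.le_mul_of_pos_left n hJ0), ?_⟩
  have hnr : (0 : ℝ) < n := by exact_mod_cast hn0
  rw [show 2 * (J * n) = 2 * J * n by ring]
  set N := 2 * J * n with hN
  have hNr : (N : ℝ) = 2 * J * n := by rw [hN]; push_cast; ring
  have hnεN : (n : ℝ) ≤ ε * N / 2 := by rw [hNr]; nlinarith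
  have h2εN : 2 ≤ ε * N := by
    have h1 : (n₁ : ℝ) ≤ n := by exact_mod_cast hnn
    have h2 : 1 < ε * n := by
      rw [div_lt_iff₀ hε0] at hn₁
      nlinarith
    have h3 : (1 : ℝ) ≤ J := by exact_mod_cast hJ0
    rw [hNr]
    nlinarith
  have hw : δ * (J * n : ℕ) = 6 * (ε * N) := by
    rw [hNr, hε]; push_cast; ring
  rw [hw]
  -- lattice heights slightly below the line
  have hYex : ∀ j : ℕ, ∃ Y : ℤ, Even (((j * n : ℕ) : ℤ) + Y) ∧
      (Y : ℝ) ≤ α * (j * n : ℕ) - 3 * (ε * N) ∧ α * (j * n : ℕ) - 3 * (ε * N) - 2 ≤ Y := by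
    intro j
    set r := α * (j * n : ℕ) - 3 * (ε * N) with hr
    refine ⟨(j * n : ℕ) + 2 * ⌊(r - (j * n : ℕ)) / 2⌋, ?_, ?_, ?_⟩
    · exact ⟨(j * n : ℕ) + ⌊(r - (j * n : ℕ)) / 2⌋, by ring⟩
    · have := Int.floor_le ((r - (j * n : ℕ)) / 2)
      rw [Int.cast_add, Int.cast_mul, Int.cast_natCast, Int.cast_ofNat]
      linarith
    · have := Int.lt_floor_add_one ((r - (j * n : ℕ)) / 2)
      rw [Int.cast_add, Int.cast_mul, Int.cast_natCast, Int.cast_ofNat]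
      linarith
  choose Y hYe hY1 hY2 using hYex
  let F : ℕ → Set Labels := fun j => edgeGE p (j * n) ⌈(α + ε) * (j * n : ℕ)⌉
  -- `F` fails for a path that is not too high at grid columns. `G j` handles low points: a path
  -- below `Y j` that still reaches (α - ε)N would have to rise at slope at least α + ε over the
  -- remaining columns.
  let G : ℕ → Set Labels := fun j => shift (j * n) (Y j) (hYe j) ⁻¹' F (2 * J - j)
  have hbad : (tube p 0 0 N (6 * (ε * N)) α)ᶜ ⊆
      (edgeGE p N ⌈(α - ε) * N⌉)ᶜ ∪ ((⋃ j ∈ Finset.Icc 1 (2 * J), F j) ∪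
        ⋃ j ∈ Finset.range (2 * J), G j) := by
    intro U hU
    by_contra hgood
    simp only [Set.mem_union, Set.mem_iUnion, not_or, not_exists] at hgood
    obtain ⟨hA, hF, hG⟩ := hgood
    rw [Set.mem_compl_iff, not_not] at hA
    obtain ⟨h, h1, h2, h3⟩ := hA
    rw [Int.ceil_le] at h3
    refine hU ⟨h, by rwa [zero_add], fun m _ hm => ?_⟩
    rw [zero_add] at hm
    have hgrid : ∀ j ≤ 2 * J, (h (j * n) : ℝ) ≤ α * (j * n : ℕ) + ε * N ∧
        α * (j * n : ℕ) - 3 * (ε * N) - 2 ≤ h (j * n) := by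
      intro j hj
      have hjN : j * n ≤ N := Nat.mul_le_mul_right n hj
      have hjNr : ((j * n : ℕ) : ℝ) ≤ N := by exact_mod_cast hjN
      constructor
      · rcases Nat.eq_zero_or_pos j with rfl | hj0
        · have : (h 0 : ℝ) ≤ 0 := by exact_mod_cast h2
          simp only [zero_mul, Nat.cast_zero, mul_zero, zero_add]
          linarith
        · have h4 : U ∈ edgeGE p (j * n) (h (j * n)) := ⟨h, h1.sub le_rfl hjN, h2, le_rfl⟩
          have h5 := edge_lt_of_notMem h4 (hF j (Finset.mem_Icc.2 ⟨hj0, hj⟩))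
          nlinarith
      · rcases hj.eq_or_lt with rfl | hj'
        · have : (((2 * J * n : ℕ) : ℕ) : ℝ) = N := rfl
          rw [this]
          linarith
        · refine (hY2 j).trans ?_
          by_contra hlt
          rw [not_le] at hlt
          have hlt' : h (j * n) ≤ Y j := by exact_mod_cast hlt.le
          refine hG j (Finset.mem_range.2 hj') ?_
          have hsum : (2 * J - j) * n + j * n = N := by
            rw [← add_mul, Nat.sub_add_cancel hj]
          refine ⟨fun k => h (k + j * n) - Y j, IsPath.to_shift (hYe j) ?_, ?_, ?_⟩
          · rw [hsum, zero_add]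
            exact h1.sub (Nat.zero_le _) le_rfl
          · simpa using hlt'
          · rw [Int.ceil_le]
            dsimp only
            rw [hsum]
            have h5 : (((2 * J - j) * n : ℕ) : ℝ) = N - (j * n : ℕ) := by
              rw [← hsum]; push_cast; ring
            have h6 : (0 : ℝ) ≤ ε * (j * n : ℕ) := by positivity
            rw [h5]
            push_cast
            have h7 := hY1 j
            push_cast at h7 h6
            linarith
    have hm1 : m / n * n ≤ m := Nat.div_mul_le_self m n
    have hm2 : m < m / n * n + n := Nat.lt_div_mul_add hn0
    have hj : m / n ≤ 2 * J := by
      rw [hN] at hm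
      exact Nat.div_le_of_le_mul (by rwa [mul_comm])
    have h4 := hgrid (m / n) hj
    have h5 := h1.dist (Nat.zero_le _) hm1 hm
    have h6 : |(h m : ℝ) - h (m / n * n)| ≤ (m : ℝ) - (m / n * n : ℕ) := by exact_mod_cast h5
    have h7 : (m : ℝ) < (m / n * n : ℕ) + n := by exact_mod_cast hm2
    have h8 : ((m / n * n : ℕ) : ℝ) ≤ m := by exact_mod_cast hm1
    rw [abs_le] at h6 ⊢
    push_cast only [Int.cast_zero, Nat.cast_zero]
    have h9 : α * ((m : ℝ) - (m / n * n : ℕ)) ≤ n := by nlinarith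
    have h10 : 0 ≤ α * ((m : ℝ) - (m / n * n : ℕ)) := mul_nonneg hα0 (by linarith)
    constructor <;> nlinarith [h6.1, h6.2, h4.1, h4.2]
  refine (measureReal_mono hbad).trans ((measureReal_union_le _ _).trans ?_)
  have hF : law.real (⋃ j ∈ Finset.Icc 1 (2 * J), F j) ≤ κ / 4 := by
    refine (measureReal_biUnion_finset_le _ _).trans
      ((Finset.sum_le_card_nsmul _ _ κ' fun j hj => (hn1 j hj).le).trans (le_of_eq ?_))
    rw [Nat.card_Icc, nsmul_eq_mul, hκ', Nat.add_sub_cancel]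
    push_cast
    field_simp
    ring
  have hG : law.real (⋃ j ∈ Finset.range (2 * J), G j) ≤ κ / 4 := by
    refine (measureReal_biUnion_finset_le _ _).trans
      ((Finset.sum_le_card_nsmul _ _ κ' fun j hj => ?_).trans (le_of_eq ?_))
    · have h2 : law.real (G j) = law.real (F (2 * J - j)) :=
        measureReal_shift_preimage _ (measurableSet_edgeGE _ _ _)
      rw [Finset.mem_range] at hj
      rw [h2]
      exact (hn1 _ (Finset.mem_Icc.2 ⟨by omega, by omega⟩)).le
    · rw [Finset.card_range, nsmul_eq_mul, hκ']
      push_cast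
      field_simp
      ring
  linarith [hn2, measureReal_union_le (μ := law) (⋃ j ∈ Finset.Icc 1 (2 * J), F j)
    (⋃ j ∈ Finset.range (2 * J), G j)]

/-! ### Lanes: concatenations of tubes -/

/-- There is a path over the columns `0, …, N * ℓ` near the line through `(0, y)` whose
slope is the last argument; over the first `ℓ` columns it stays within distance `w` of the line of
slope `a`. -/
def lane (p : ℝ) (y : ℤ) (ℓ N : ℕ) (w a a' : ℝ) : Set Labels :=
  pathEvent p 0 (N * ℓ) fun h =>
    (∀ n : ℕ, n ≤ N * ℓ → |(h n : ℝ) - (y + a' * n)| ≤ 4 * ℓ) ∧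
      ∀ n : ℕ, n ≤ ℓ → |(h n : ℝ) - (y + a * n)| ≤ w

/-- Tubes of slope `a` along a line of smaller slope `D / ℓ`, consecutive ones joined by a tube
of slope `-a`, yield a lane. -/
lemma mem_lane {ℓ N : ℕ} (hℓ : 0 < ℓ) (hN : 1 ≤ N) {w a a' : ℝ} (hw : 0 ≤ w) (ha : a ≤ 1)
    {y D Y : ℤ} (hD1 : a * ℓ - 2 * w - 2 ≤ D) (hD2 : D ≤ a * ℓ - 2 * w)
    (hY1 : a * ℓ + 2 * w ≤ Y) (hY2 : Y ≤ a * ℓ + 2 * w + 2) (ha' : a' * ℓ = D)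
    (hwa : 6 * w + 4 ≤ 2 * a * ℓ)
    (hA : ∀ i < N, U ∈ tube p (i * ℓ) (y + i * D) (2 * ℓ) w a)
    (hB : ∀ i < N, U ∈ tube p ((i + 1) * ℓ) (y + i * D + Y) (2 * ℓ) w (-a)) :
    U ∈ lane p y ℓ N w a a' := by
  have hℓr : (0 : ℝ) < ℓ := by exact_mod_cast hℓ
  choose! A hAp hAw using hA
  choose! B hBp hBw using hB
  have haa : a' ≤ a := by
    have : a' * ℓ ≤ a * ℓ := by linarith
    exact le_of_mul_le_mul_right this hℓr
  have haa0 : 0 ≤ a + a' := by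
    have : 0 * (ℓ : ℝ) ≤ (a + a') * ℓ := by nlinarith
    exact le_of_mul_le_mul_right this hℓr
  have haℓ : a * ℓ ≤ ℓ := by nlinarith
  have hA1 : ∀ i < N, ∀ τ : ℕ, τ ≤ 2 * ℓ →
      |(A i (i * ℓ + τ) : ℝ) - (y + i * D + a * τ)| ≤ w := by
    intro i hi τ hτ
    have h1 := hAw i hi (i * ℓ + τ) (by omega) (by omega)
    push_cast at h1
    rwa [show (i : ℝ) * ℓ + τ - i * ℓ = τ by ring] at h1
  have hB1 : ∀ i < N, ∀ τ : ℕ, τ ≤ 2 * ℓ →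
      |(B i ((i + 1) * ℓ + τ) : ℝ) - (y + i * D + Y - a * τ)| ≤ w := by
    intro i hi τ hτ
    have h1 := hBw i hi ((i + 1) * ℓ + τ) (by omega) (by omega)
    push_cast at h1
    rwa [show ((i : ℝ) + 1) * ℓ + τ - (i + 1) * ℓ = τ by ring, neg_mul, ← sub_eq_add_neg] at h1
  let S : Set (ℕ × ℤ) := {z | |(z.2 : ℝ) - (y + a' * z.1)| ≤ 4 * ℓ}
  have hAS : ∀ i < N, GraphIn (A i) (i * ℓ) (i * ℓ + 2 * ℓ) S := by
    intro i hi n hn hn'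
    obtain ⟨τ, rfl⟩ := Nat.exists_eq_add_of_le hn
    have hτ : τ ≤ 2 * ℓ := by omega
    have hτr : (τ : ℝ) ≤ 2 * ℓ := by exact_mod_cast hτ
    have h1 := hA1 i hi τ hτ
    change |(A i (i * ℓ + τ) : ℝ) - (y + a' * ((i * ℓ + τ : ℕ) : ℝ))| ≤ 4 * ℓ
    have h2 : a' * ((i * ℓ + τ : ℕ) : ℝ) = i * D + a' * τ := by
      push_cast
      linear_combination (i : ℝ) * ha'
    have h3 : (a - a') * τ ≤ (a - a') * (2 * ℓ) :=
      mul_le_mul_of_nonneg_left hτr (by linarith)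
    have h4 : 0 ≤ (a - a') * τ := mul_nonneg (by linarith) (Nat.cast_nonneg τ)
    rw [h2]
    rw [abs_le] at h1 ⊢
    constructor <;> linarith [h1.1, h1.2]
  have hBS : ∀ i < N, GraphIn (B i) ((i + 1) * ℓ) ((i + 1) * ℓ + ℓ) S := by
    intro i hi n hn hn'
    obtain ⟨τ, rfl⟩ := Nat.exists_eq_add_of_le hn
    have hτ : τ ≤ ℓ := by omega
    have hτr : (τ : ℝ) ≤ ℓ := by exact_mod_cast hτ
    have h1 := hB1 i hi τ (by omega)
    change |(B i ((i + 1) * ℓ + τ) : ℝ) - (y + a' * (((i + 1) * ℓ + τ : ℕ) : ℝ))| ≤ 4 * ℓ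
    have h2 : a' * (((i + 1) * ℓ + τ : ℕ) : ℝ) = (i + 1) * D + a' * τ := by
      push_cast
      linear_combination ((i : ℝ) + 1) * ha'
    have h3 : (a + a') * τ ≤ (a + a') * ℓ := mul_le_mul_of_nonneg_left hτr haa0
    have h4 : 0 ≤ (a + a') * τ := mul_nonneg haa0 (Nat.cast_nonneg τ)
    rw [h2]
    rw [abs_le] at h1 ⊢
    constructor <;> linarith [h1.1, h1.2]
  have hreach : ∀ i < N, Reach p U S ℓ (A 0 ℓ) ((i + 1) * ℓ) (A i ((i + 1) * ℓ)) := by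
    intro i
    induction i with
    | zero =>
      intro hi
      have h1 := (hAp 0 hi).reach (hAS 0 hi) (m := ℓ) (n := ℓ) (by omega) le_rfl (by omega)
      simpa using h1
    | succ i ih =>
      intro hi
      have hi' : i < N := by omega
      have e1 : (i + 1 + 1) * ℓ = (i + 1) * ℓ + ℓ := by ring
      have e2 : (i + 1) * ℓ = i * ℓ + ℓ := by ring
      have hpA := (hAp i hi').sub (s' := (i + 1) * ℓ) (e' := (i + 1 + 1) * ℓ) (by omega) (by omega)
      have hpB := (hBp i hi').sub (s' := (i + 1) * ℓ) (e' := (i + 1 + 1) * ℓ) le_rfl (by omega)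
      have hpA' := (hAp (i + 1) hi).sub (s' := (i + 1) * ℓ) (e' := (i + 1 + 1) * ℓ) le_rfl
        (by omega)
      -- On the `ℓ` columns shared by tubes `i` and `i + 1`, the connector starts above the former
      -- because of `hY1`, and ends below the latter because its descent and their ascent, 2aℓ in
      -- all, exceed 6w + 4. By `hD2` the later tube lies below the earlier one.
      refine (ih hi').trans (reach_of_connector hpA hpB hpA' (by omega)
        (fun n hn hn' => hAS i hi' n (by omega) (by omega))
        (fun n hn hn' => hBS i hi' n (by omega) (by omega))
        (fun n hn hn' => hAS (i + 1) hi n (by omega) (by omega)) ?_ ?_ ?_)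
      · have h1 := hA1 i hi' ℓ (by omega)
        have h2 := hB1 i hi' 0 (by omega)
        rw [← e2] at h1
        rw [add_zero, Nat.cast_zero, mul_zero, sub_zero] at h2
        rw [abs_le] at h1 h2
        have h3 : (A i ((i + 1) * ℓ) : ℝ) ≤ B i ((i + 1) * ℓ) := by linarith [h1.2, h2.1]
        exact_mod_cast h3
      · have h1 := hA1 (i + 1) hi ℓ (by omega)
        have h2 := hB1 i hi' ℓ (by omega)
        rw [← e1] at h1 h2
        rw [abs_le] at h1 h2
        push_cast at h1
        have h3 : (B i ((i + 1 + 1) * ℓ) : ℝ) ≤ A (i + 1) ((i + 1 + 1) * ℓ) := by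
          linarith [h1.1, h2.2]
        exact_mod_cast h3
      · intro n hn hn'
        obtain ⟨τ, rfl⟩ := Nat.exists_eq_add_of_le hn
        have hτ : τ ≤ ℓ := by omega
        have h1 := hA1 i hi' (ℓ + τ) (by omega)
        have h2 := hA1 (i + 1) hi τ (by omega)
        rw [show i * ℓ + (ℓ + τ) = (i + 1) * ℓ + τ by ring] at h1
        rw [abs_le] at h1 h2
        push_cast at h1 h2
        have h3 : (A (i + 1) ((i + 1) * ℓ + τ) : ℝ) ≤ A i ((i + 1) * ℓ + τ) := by
          linarith [h1.1, h2.2]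
        exact_mod_cast h3
  obtain ⟨hle, P, hP, hPS, hP0, -⟩ := hreach (N - 1) (by omega)
  rw [Nat.sub_add_cancel hN] at hP hPS hle
  have hA0 := hAp 0 (by omega)
  refine ⟨_, (hA0.sub (s' := 0) (e' := ℓ) (by omega) (by omega)).glue hP (Nat.zero_le ℓ) hle
    hP0.symm, ?_, ?_⟩
  · intro n hn
    dsimp only
    split_ifs with h1
    · exact hAS 0 (by omega) n (by omega) (by omega)
    · exact hPS n (by omega) hn
  · intro n hn
    dsimp only
    rw [if_pos hn]
    have h1 := hA1 0 (by omega) n (by omega)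
    simpa using h1

/-- The probability that a lane fails is controlled by that of a tube. -/
lemma exists_lane_slope {ℓ : ℕ} (hℓ : 0 < ℓ) {w a : ℝ} (hw : 0 ≤ w) (ha : a ≤ 1)
    (hwa : 6 * w + 4 ≤ 2 * a * ℓ) :
    ∃ a' : ℝ, a' ≤ a ∧ a - (2 * w + 2) / ℓ ≤ a' ∧ ∀ (p : ℝ) (N : ℕ) (y : ℤ), 1 ≤ N → Even y →
      law.real (lane p y ℓ N w a a')ᶜ ≤ 2 * N * law.real (tube p 0 0 (2 * ℓ) w a)ᶜ := by
  have hℓr : (0 : ℝ) < ℓ := by exact_mod_cast hℓ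
  -- `D` and `Y` get the parity of `ℓ`, so that all tubes start at lattice sites; the rounding costs
  -- at most 2.
  set D : ℤ := ℓ + 2 * ⌊(a * ℓ - 2 * w - ℓ) / 2⌋ with hD
  set Y : ℤ := ℓ + 2 * ⌈(a * ℓ + 2 * w - ℓ) / 2⌉ with hY
  have hDr : (D : ℝ) = ℓ + 2 * ⌊(a * ℓ - 2 * w - ℓ) / 2⌋ := by rw [hD]; push_cast; ring
  have hYr : (Y : ℝ) = ℓ + 2 * ⌈(a * ℓ + 2 * w - ℓ) / 2⌉ := by rw [hY]; push_cast; ring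
  have hD1 : a * ℓ - 2 * w - 2 ≤ D := by
    rw [hDr]; linarith [Int.lt_floor_add_one ((a * ℓ - 2 * w - ℓ) / 2)]
  have hD2 : (D : ℝ) ≤ a * ℓ - 2 * w := by
    rw [hDr]; linarith [Int.floor_le ((a * ℓ - 2 * w - ℓ) / 2)]
  have hY1 : a * ℓ + 2 * w ≤ Y := by
    rw [hYr]; linarith [Int.le_ceil ((a * ℓ + 2 * w - ℓ) / 2)]
  have hY2 : (Y : ℝ) ≤ a * ℓ + 2 * w + 2 := by
    rw [hYr]; linarith [Int.ceil_lt_add_one ((a * ℓ + 2 * w - ℓ) / 2)]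
  refine ⟨D / ℓ, ?_, ?_, ?_⟩
  · rw [div_le_iff₀ hℓr]; linarith
  · rw [le_div_iff₀ hℓr, sub_mul, div_mul_cancel₀ _ hℓr.ne']; linarith
  intro p N y hN hy
  have hDe : ∀ i : ℕ, Even (((i * ℓ : ℕ) : ℤ) + (y + i * D)) := by
    intro i
    obtain ⟨c, rfl⟩ := hy
    exact ⟨i * ℓ + c + i * ⌊(a * ℓ - 2 * w - ℓ) / 2⌋, by rw [hD]; push_cast; ring⟩
  have hYe : ∀ i : ℕ, Even ((((i + 1) * ℓ : ℕ) : ℤ) + (y + i * D + Y)) := by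
    intro i
    have h1 := (hDe i).add (show Even ((ℓ : ℤ) + Y) from
      ⟨ℓ + ⌈(a * ℓ + 2 * w - ℓ) / 2⌉, by rw [hY]; ring⟩)
    rwa [show (((i + 1) * ℓ : ℕ) : ℤ) + (y + i * D + Y) =
      ((i * ℓ : ℕ) : ℤ) + (y + i * D) + (ℓ + Y) by push_cast; ring]
  have hsub : (lane p y ℓ N w a (D / ℓ))ᶜ ⊆ ⋃ i ∈ Finset.range N,
      ((tube p (i * ℓ) (y + i * D) (2 * ℓ) w a)ᶜ ∪
        (tube p ((i + 1) * ℓ) (y + i * D + Y) (2 * ℓ) w (-a))ᶜ) := by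
    intro U hU
    by_contra hno
    simp only [Set.mem_iUnion, Set.mem_union, Set.mem_compl_iff, Finset.mem_range, not_exists,
      not_or, not_not] at hno
    exact hU (mem_lane hℓ hN hw ha hD1 hD2 hY1 hY2 (div_mul_cancel₀ _ hℓr.ne') hwa
      (fun i hi => (hno i hi).1) fun i hi => (hno i hi).2)
  refine (measureReal_mono hsub (measure_ne_top _ _)).trans
    ((measureReal_biUnion_finset_le _ _).trans ?_)
  refine (Finset.sum_le_card_nsmul _ _ (2 * law.real (tube p 0 0 (2 * ℓ) w a)ᶜ)
    fun i _ => ?_).trans (le_of_eq ?_)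
  · refine (measureReal_union_le _ _).trans ?_
    linarith [tube_compl_le (p := p) (hDe i) (2 * ℓ) w a,
      tube_neg_compl_le (p := p) (hYe i) (2 * ℓ) w a]
  · rw [Finset.card_range, nsmul_eq_mul]
    ring

lemma lane_subset_tube {ℓ N : ℕ} {w a a' : ℝ} :
    lane p 0 ℓ N w a a' ⊆ tube p 0 0 (N * ℓ) (4 * ℓ) a' := by
  rintro U ⟨h, h1, h2, -⟩
  refine ⟨h, by rwa [zero_add], fun n _ hn => ?_⟩
  have h3 := h2 n (by omega)
  simpa using h3

/-! ### Multiscale analysis -/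

/-- The factor between the lengths at scales `k` and `k + 1`. -/
def scaleFactor (M k : ℕ) : ℕ := M * 2 ^ k

/-- Half the length of the tubes at scale `k`. -/
def scaleLength (M l : ℕ) : ℕ → ℕ
  | 0 => l
  | k + 1 => scaleFactor M k * scaleLength M l k

/-- The width of the tubes at scale `k`. -/
def scaleWidth (M l k : ℕ) : ℝ := 20 * scaleLength M l k / scaleFactor M k

/-- The bound for the probability that a tube at scale `k` is not crossed. -/
def scaleBound (M k : ℕ) : ℝ := (1 / 4) ^ k / (256 * (scaleFactor M k : ℝ) ^ 2)

section Scales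

variable {M l k : ℕ}

lemma scaleFactor_succ : (scaleFactor M (k + 1) : ℝ) = 2 * scaleFactor M k := by
  simp only [scaleFactor, pow_succ]; push_cast; ring

lemma le_scaleFactor : M ≤ scaleFactor M k := Nat.le_mul_of_pos_right M (by positivity)

lemma scaleLength_succ :
    scaleLength M l (k + 1) = scaleFactor M k * scaleLength M l k := rfl

lemma scaleFactor_le_scaleLength (hM : 2 ≤ M) (hl : M ≤ l) :
    scaleFactor M k ≤ scaleLength M l k := by
  induction k with
  | zero => simpa [scaleFactor, scaleLength] using hl
  | succ k ih =>
    have h1 : scaleFactor M (k + 1) = scaleFactor M k * 2 := by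
      simp only [scaleFactor, pow_succ]; ring
    rw [scaleLength_succ, h1]
    exact Nat.mul_le_mul_left _ (hM.trans (le_scaleFactor.trans ih))

lemma scaleWidth_succ (hM : 2 ≤ M) : scaleWidth M l (k + 1) = 10 * scaleLength M l k := by
  have h1 : 0 < scaleFactor M k := lt_of_lt_of_le (by omega) le_scaleFactor
  have h2 : (0 : ℝ) < scaleFactor M k := by exact_mod_cast h1
  rw [scaleWidth, scaleFactor_succ, scaleLength_succ]
  push_cast
  field_simp
  ring

lemma scaleWidth_nonneg : 0 ≤ scaleWidth M l k := by
  unfold scaleWidth; positivity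

lemma scaleBound_nonneg : 0 ≤ scaleBound M k := by
  unfold scaleBound; positivity

/-- If one tube is crossed with high probability, then so are tubes and lanes at all larger
scales, with a small total loss of slope. -/
lemma exists_slopes {b a₀ : ℝ} (hb : 0 < b) (ha₀ : a₀ ≤ 1) (hM2 : 2 ≤ M) (hM : 62 ≤ b * M)
    (hl : M ≤ l) (hgap : b + 84 / M ≤ a₀)
    (hq : law.real (tube p 0 0 (2 * l) (20 * l / M) a₀)ᶜ ≤ 1 / (256 * (M : ℝ) ^ 2)) :
    ∃ a : ℕ → ℝ, ∀ k, b + 84 / scaleFactor M k ≤ a k ∧ a k ≤ 1 ∧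
      law.real (tube p 0 0 (2 * scaleLength M l k) (scaleWidth M l k) (a k))ᶜ ≤ scaleBound M k ∧
      ∀ y : ℤ, Even y → law.real (lane p y (scaleLength M l k) (2 * scaleFactor M k)
        (scaleWidth M l k) (a k) (a (k + 1)))ᶜ ≤ 4 * scaleFactor M k * scaleBound M k := by
  -- The slope keeps a reserve of 84 divided by the scale factor. A step loses at most half of it,
  -- and the factor doubles, so the remaining half is exactly the next reserve.
  let Inv : ℕ → ℝ → Prop := fun k a => b + 84 / scaleFactor M k ≤ a ∧ a ≤ 1 ∧
      law.real (tube p 0 0 (2 * scaleLength M l k) (scaleWidth M l k) a)ᶜ ≤ scaleBound M k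
  have step : ∀ k a, Inv k a → ∃ a', Inv (k + 1) a' ∧
      ∀ y : ℤ, Even y → law.real (lane p y (scaleLength M l k) (2 * scaleFactor M k)
        (scaleWidth M l k) a a')ᶜ ≤ 4 * scaleFactor M k * scaleBound M k := by
    rintro k a ⟨h1, h2, h3⟩
    have hMk : 0 < scaleFactor M k := lt_of_lt_of_le (by omega) le_scaleFactor
    have hMl : scaleFactor M k ≤ scaleLength M l k := scaleFactor_le_scaleLength hM2 hl
    have hMkr : (0 : ℝ) < scaleFactor M k := by exact_mod_cast hMk
    have hMlr : (scaleFactor M k : ℝ) ≤ scaleLength M l k := by exact_mod_cast hMl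
    have hMMr : (M : ℝ) ≤ scaleFactor M k := by exact_mod_cast le_scaleFactor
    have hlr : (0 : ℝ) < scaleLength M l k := by linarith
    have hl1 : (1 : ℝ) ≤ scaleLength M l k := by exact_mod_cast (hMk.trans_le hMl)
    have hwM : scaleWidth M l k * scaleFactor M k = 20 * scaleLength M l k := by
      rw [scaleWidth, div_mul_cancel₀ _ hMkr.ne']
    have hab : b ≤ a := le_trans (by have : 0 ≤ 84 / (scaleFactor M k : ℝ) := by positivity
                                     linarith) h1
    -- Multiplied by the scale factor, the left side is at most 120 + 4 = 124 lengths; this is where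
    -- 62 comes from.
    have hcond : 6 * scaleWidth M l k + 4 ≤ 2 * a * scaleLength M l k := by
      have h4 : (6 * scaleWidth M l k + 4) * scaleFactor M k ≤
          (2 * a * scaleLength M l k) * scaleFactor M k := by
        have h5 : 62 ≤ a * scaleFactor M k := hM.trans (by gcongr; linarith)
        nlinarith
      exact le_of_mul_le_mul_right h4 hMkr
    obtain ⟨a', ha1, ha2, ha3⟩ := exists_lane_slope (hMk.trans_le hMl) scaleWidth_nonneg h2 hcond
    have hlane : ∀ y : ℤ, Even y → law.real (lane p y (scaleLength M l k) (2 * scaleFactor M k)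
        (scaleWidth M l k) a a')ᶜ ≤ 4 * scaleFactor M k * scaleBound M k := by
      intro y hy
      refine (ha3 p (2 * scaleFactor M k) y (by omega) hy).trans ?_
      push_cast
      rw [show 2 * (2 * (scaleFactor M k : ℝ)) = 4 * scaleFactor M k by ring]
      gcongr
    refine ⟨a', ⟨?_, ha1.trans h2, ?_⟩, hlane⟩
    · have h4 : (2 * scaleWidth M l k + 2) / scaleLength M l k ≤ 42 / scaleFactor M k := by
        rw [div_le_div_iff₀ hlr hMkr]
        nlinarith
      rw [scaleFactor_succ]
      have h5 : 84 / (2 * (scaleFactor M k : ℝ)) = 42 / scaleFactor M k := by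
        field_simp; norm_num
      have h6 : 84 / (scaleFactor M k : ℝ) = 42 / scaleFactor M k + 42 / scaleFactor M k := by
        ring
      rw [h5]
      linarith
    · have h4 : law.real (tube p 0 0 (2 * scaleLength M l (k + 1))
          (4 * scaleLength M l k) a')ᶜ ≤ 4 * scaleFactor M k * scaleBound M k := by
        refine le_trans (measureReal_mono (Set.compl_subset_compl.2 ?_)) (hlane 0 Even.zero)
        rw [scaleLength_succ, ← mul_assoc]
        exact lane_subset_tube
      have h5 := tube_double (p := p) (L := 2 * scaleLength M l (k + 1))
        (w := 4 * scaleLength M l k) (a := a') (by positivity)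
      have h6 : tube p 0 0 (2 * scaleLength M l (k + 1)) (2 * (4 * scaleLength M l k) + 2) a' ⊆
          tube p 0 0 (2 * scaleLength M l (k + 1)) (scaleWidth M l (k + 1)) a' := by
        refine pathEvent_mono le_rfl fun h hh n hn hn' => (hh n hn hn').trans ?_
        rw [scaleWidth_succ hM2]
        linarith
      refine (measureReal_mono (Set.compl_subset_compl.2 h6)).trans (h5.trans ?_)
      refine (pow_le_pow_left₀ measureReal_nonneg h4 2).trans ?_
      -- A lane of 2M_k tubes and as many connectors fails with probability at most 4M_k times the
      -- bound at scale k. Doubling the width squares this, leaving a factor (1/4)^k to spare.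
      have h7 : ((1 : ℝ) / 4) ^ k ≤ 1 := pow_le_one₀ (by norm_num) (by norm_num)
      have h8 : (0 : ℝ) < (1 / 4) ^ k := by positivity
      rw [scaleBound, scaleBound, scaleFactor_succ, pow_succ (1 / 4 : ℝ) k]
      set x : ℝ := (1 / 4) ^ k with hx
      have e1 : (4 * (scaleFactor M k : ℝ) * (x / (256 * (scaleFactor M k : ℝ) ^ 2))) ^ 2 =
          x * (x / (4096 * (scaleFactor M k : ℝ) ^ 2)) := by
        field_simp; ring
      have e2 : x * (1 / 4) / (256 * (2 * (scaleFactor M k : ℝ)) ^ 2) =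
          x / (4096 * (scaleFactor M k : ℝ) ^ 2) := by
        field_simp; ring
      rw [e1, e2]
      exact mul_le_of_le_one_left (by positivity) h7
  choose! nxt hnxt hlane using step
  let a : ℕ → ℝ := fun k => Nat.rec a₀ (fun k x => nxt k x) k
  have hInv : ∀ k, Inv k (a k) := by
    intro k
    induction k with
    | zero =>
      change Inv 0 a₀
      refine ⟨by simpa [scaleFactor] using hgap, ha₀, ?_⟩
      simpa [scaleFactor, scaleLength, scaleWidth, scaleBound] using hq
    | succ k ih => exact hnxt k (a k) ih
  exact ⟨a, fun k => ⟨(hInv k).1, (hInv k).2.1, (hInv k).2.2, hlane k (a k) (hInv k)⟩⟩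

lemma scaleBound_le (hM : 2 ≤ M) : scaleFactor M k * scaleBound M k ≤ (1 / 4) ^ k / 256 := by
  have h1 : (1 : ℝ) ≤ scaleFactor M k := by
    exact_mod_cast (show 1 ≤ scaleFactor M k from le_trans (by omega) le_scaleFactor)
  have h2 : (0 : ℝ) < (1 / 4) ^ k := by positivity
  rw [scaleBound, mul_div_assoc', div_le_div_iff₀ (by positivity) (by norm_num)]
  nlinarith [mul_le_mul_of_nonneg_left h1 (show (0 : ℝ) ≤ (1 / 4) ^ k * scaleFactor M k by
    positivity)]

end Scales

/-- High crossing probabilities of tubes bound the edge speed from below. -/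
lemma le_edgeSpeed_of_tube {b a₀ : ℝ} {M l : ℕ} (hb : 0 < b) (ha₀ : a₀ ≤ 1) (hM2 : 2 ≤ M)
    (hM : 62 ≤ b * M) (hl : M ≤ l) (hgap : b + 84 / M ≤ a₀)
    (hq : law.real (tube p 0 0 (2 * l) (20 * l / M) a₀)ᶜ ≤ 1 / (256 * (M : ℝ) ^ 2)) :
    (b : EReal) ≤ edgeSpeed p := by
  obtain ⟨a, ha⟩ := exists_slopes hb ha₀ hM2 hM hl hgap hq
  by_contra hlt
  rw [not_le] at hlt
  have h1 := tendsto_edgeGE_of_edgeSpeed_lt hlt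
  have hlen : Filter.Tendsto (fun k => 2 * scaleLength M l k) Filter.atTop Filter.atTop := by
    refine Filter.tendsto_atTop_mono (fun k => ?_) Filter.tendsto_id
    have h2 : k < 2 ^ k := Nat.lt_two_pow_self
    have h3 : 1 * 2 ^ k ≤ scaleFactor M k := Nat.mul_le_mul_right _ (by omega)
    have h4 := scaleFactor_le_scaleLength (k := k) hM2 hl
    simp only [id]
    omega
  obtain ⟨k, hk⟩ := ((h1.comp hlen).eventually (gt_mem_nhds (show (0 : ℝ) < 1 / 2 by
    norm_num))).exists
  obtain ⟨h2, h3, h4, -⟩ := ha k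
  have hMk : 0 < scaleFactor M k := lt_of_lt_of_le (by omega) le_scaleFactor
  have hMl : scaleFactor M k ≤ scaleLength M l k := scaleFactor_le_scaleLength hM2 hl
  have hMkr : (0 : ℝ) < scaleFactor M k := by exact_mod_cast hMk
  have hMlr : (scaleFactor M k : ℝ) ≤ scaleLength M l k := by exact_mod_cast hMl
  have hw0 : 0 ≤ scaleWidth M l k := scaleWidth_nonneg
  set w := scaleWidth M l k with hw
  have hwM : w * scaleFactor M k = 20 * scaleLength M l k := by
    rw [hw, scaleWidth, div_mul_cancel₀ _ hMkr.ne']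
  -- Lowering the tube by at least its width makes every crossing start at height at most 0, so that
  -- it is counted by the edge.
  set y : ℤ := 2 * ⌈w / 2⌉ with hy
  have hyr : (y : ℝ) = 2 * ⌈w / 2⌉ := by rw [hy]; push_cast; ring
  have hy1 : w ≤ y := by rw [hyr]; linarith [Int.le_ceil (w / 2)]
  have hy2 : (y : ℝ) ≤ w + 2 := by rw [hyr]; linarith [Int.ceil_lt_add_one (w / 2)]
  have hsub : tube p 0 (-y) (2 * scaleLength M l k) w (a k) ⊆
      edgeGE p (2 * scaleLength M l k) ⌈b * (2 * scaleLength M l k : ℕ)⌉ := by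
    rintro U ⟨h, h5, h6⟩
    rw [zero_add] at h5
    refine ⟨h, h5, ?_, ?_⟩
    · have h7 := (abs_le.1 (h6 0 le_rfl (Nat.zero_le _))).2
      push_cast at h7
      have h8 : (h 0 : ℝ) ≤ 0 := by linarith
      exact_mod_cast h8
    · rw [Int.ceil_le]
      have h7 := (abs_le.1 (h6 (2 * scaleLength M l k) (Nat.zero_le _) (by omega))).1
      push_cast at h7 ⊢
      have h8 : 84 / (scaleFactor M k : ℝ) ≤ a k - b := by linarith
      rw [div_le_iff₀ hMkr] at h8
      have h9 : (2 * w + 2) * scaleFactor M k ≤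
          ((a k - b) * (2 * scaleLength M l k)) * scaleFactor M k := by nlinarith
      have h10 := le_of_mul_le_mul_right h9 hMkr
      linarith
  have h5 : law.real (tube p 0 (-y) (2 * scaleLength M l k) w (a k))ᶜ ≤ 1 / 256 := by
    refine (tube_compl_le (by simp [hy]) _ _ _).trans (h4.trans ?_)
    have h6 := scaleBound_le (k := k) hM2
    have h7 : (1 : ℝ) ≤ scaleFactor M k := by exact_mod_cast hMk
    have h8 : ((1 : ℝ) / 4) ^ k ≤ 1 := pow_le_one₀ (by norm_num) (by norm_num)
    nlinarith [scaleBound_nonneg (M := M) (k := k)]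
  rw [probReal_compl_eq_one_sub (measurableSet_tube _ _ _ _ _ _)] at h5
  have h6 := measureReal_mono (μ := law) hsub
  simp only [Function.comp_apply] at hk
  linarith

/-- If percolation has probability zero, then almost surely no point of the initial column is
the start of arbitrarily long paths. -/
lemma law_infinite_paths_eq_zero (h0 : percolationProb p = 0) (y : ℤ) :
    law {U | ∀ n, ∃ h, IsPath p U h 0 n ∧ h 0 = y} = 0 := by
  by_cases hy : Even y
  · have hy' : Even (((0 : ℕ) : ℤ) + y) := by simpa using hy
    refine measure_mono_null ?_
      ((measurePreserving_shift 0 y hy').quasiMeasurePreserving.preimage_null h0)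
    intro U hU
    change (cluster p _).Infinite
    rw [infinite_cluster_iff]
    intro n
    obtain ⟨h, h1, h2⟩ := hU n
    exact ⟨fun k => h (k + 0) - y, h1.to_shift hy', by simp [h2]⟩
  · have hy' : Even (((1 : ℕ) : ℤ) + y) := by
      rw [Int.even_iff] at hy ⊢
      push_cast
      omega
    refine measure_mono_null ?_
      ((measurePreserving_shift 1 y hy').quasiMeasurePreserving.preimage_null h0)
    intro U hU
    change (cluster p _).Infinite
    rw [infinite_cluster_iff]
    intro n
    obtain ⟨h, h1, h2⟩ := hU (n + 1)
    have h3 : h 1 = y := by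
      rcases h1 0 le_rfl (by omega) with h4 | h4
      · have := h4.1.even
        rw [h2] at this
        simp at this
        exact absurd this hy
      · rw [← h2]; exact h4.2
    refine ⟨fun k => h (k + 1) - y, IsPath.to_shift hy' (h1.sub (by omega) le_rfl), ?_⟩
    simp [h3]

/-- High crossing probabilities of tubes imply percolation. -/
lemma percolationProb_pos_of_tube {b a₀ : ℝ} {M l : ℕ} (hb : 0 < b) (ha₀ : a₀ ≤ 1) (hM2 : 2 ≤ M)
    (hM : 62 ≤ b * M) (hl : M ≤ l) (hgap : b + 84 / M ≤ a₀)
    (hq : law.real (tube p 0 0 (2 * l) (20 * l / M) a₀)ᶜ ≤ 1 / (256 * (M : ℝ) ^ 2)) :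
    0 < percolationProb p := by
  obtain ⟨a, ha⟩ := exists_slopes hb ha₀ hM2 hM hl hgap hq
  set ℓ : ℕ → ℕ := scaleLength M l with hℓ
  -- The drop 14 = 10 + 4 puts the start of lane k + 1 (width 10 ℓ_k) below lane k (width 4 ℓ_k).
  -- The connector offset 16 adds 2 to this, to cover the opposite slopes up to column ℓ_k.
  obtain ⟨y, hy0, hys⟩ : ∃ y : ℕ → ℤ, y 0 = 0 ∧ ∀ k, y (k + 1) = y k - 14 * (ℓ k : ℤ) :=
    ⟨fun k => Nat.rec 0 (fun k z => z - 14 * (ℓ k : ℤ)) k, rfl, fun k => rfl⟩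
  have hye : ∀ k, Even (y k) := by
    intro k
    induction k with
    | zero => simp [hy0]
    | succ k ih =>
      rw [hys]
      exact ih.sub ⟨7 * (ℓ k : ℤ), by ring⟩
  let A : ℕ → Set Labels := fun k =>
    lane p (y k) (ℓ k) (2 * scaleFactor M k) (scaleWidth M l k) (a k) (a (k + 1))
  let B : ℕ → Set Labels := fun k =>
    tube p 0 (y k + 16 * (ℓ k : ℤ)) (2 * ℓ (k + 1)) (scaleWidth M l (k + 1)) (-a (k + 1))
  have hchain : (⋂ k, A k ∩ B k) ⊆ ⋃ z : ℤ, {U | ∀ n, ∃ h, IsPath p U h 0 n ∧ h 0 = z} := by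
    intro U hU
    rw [Set.mem_iInter] at hU
    choose f hfp hfw hfw' using fun k => (hU k).1
    choose g hgp hgw using fun k => (hU k).2
    have hlen : ∀ k, 2 * scaleFactor M k * ℓ k = 2 * ℓ (k + 1) := fun k => by
      rw [hℓ, scaleLength_succ]; ring
    have hreach : ∀ k, Reach p U Set.univ 0 (f 0 0) (ℓ k) (f k (ℓ k)) := by
      intro k
      induction k with
      | zero =>
        refine (hfp 0).reach (fun _ _ _ => Set.mem_univ _) le_rfl (Nat.zero_le _) ?_
        have : 0 < scaleFactor M 0 := lt_of_lt_of_le (by omega) le_scaleFactor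
        exact Nat.le_mul_of_pos_left _ (by omega)
      | succ k ih =>
        refine ih.trans ?_
        obtain ⟨h2, h3, -, -⟩ := ha (k + 1)
        have hMk : 0 < scaleFactor M k := lt_of_lt_of_le (by omega) le_scaleFactor
        have hMMr : (M : ℝ) ≤ scaleFactor M k := by exact_mod_cast le_scaleFactor
        have hle : ℓ k ≤ ℓ (k + 1) := Nat.le_mul_of_pos_left _ hMk
        have hlr : (ℓ (k + 1) : ℝ) = scaleFactor M k * ℓ k := by
          rw [hℓ, scaleLength_succ]; push_cast; ring
        have hl0 : (0 : ℝ) ≤ ℓ k := Nat.cast_nonneg _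
        have hab : b ≤ a (k + 1) := le_trans (by
          have : 0 ≤ 84 / (scaleFactor M (k + 1) : ℝ) := by positivity
          linarith) h2
        have hw : scaleWidth M l (k + 1) = 10 * (ℓ k : ℝ) := scaleWidth_succ hM2
        have hlane := hfw k
        rw [hlen k] at hlane
        have hfk := hfp k
        rw [hlen k] at hfk
        have hfk' := hfp (k + 1)
        have hle' : ℓ (k + 1) ≤ 2 * scaleFactor M (k + 1) * ℓ (k + 1) := by
          have : 0 < scaleFactor M (k + 1) := lt_of_lt_of_le (by omega) le_scaleFactor
          exact Nat.le_mul_of_pos_left _ (by omega)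
        have hyr : (y (k + 1) : ℝ) = (y k : ℝ) - 14 * (ℓ k : ℝ) := by rw [hys]; push_cast; ring
        -- Up to column ℓ_{k+1}, lane k and the initial part of lane k + 1 both follow the slope `a
        -- (k + 1)`, so they stay ordered while the reflected tube crosses from the first to the
        -- second.
        refine reach_of_connector (hfk.sub (Nat.zero_le _) (by omega))
          ((hgp k).sub (Nat.zero_le _) (by omega)) (hfk'.sub (Nat.zero_le _) hle') hle
          (fun _ _ _ => Set.mem_univ _) (fun _ _ _ => Set.mem_univ _)
          (fun _ _ _ => Set.mem_univ _) ?_ ?_ ?_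
        · have h4 := (abs_le.1 (hlane (ℓ k) (by omega))).2
          have h5 := (abs_le.1 (hgw k (ℓ k) (Nat.zero_le _) (by omega))).1
          rw [hw] at h5
          push_cast at h5
          have h6 : (f k (ℓ k) : ℝ) ≤ g k (ℓ k) := by nlinarith
          exact_mod_cast h6
        · have h4 := (abs_le.1 (hgw k (ℓ (k + 1)) (Nat.zero_le _) (by omega))).2
          have h5 := (abs_le.1 (hfw' (k + 1) (ℓ (k + 1)) le_rfl)).1
          rw [hw] at h4 h5
          push_cast at h4
          have h7 : 62 ≤ a (k + 1) * scaleFactor M k := hM.trans (by gcongr; linarith)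
          have h8 : 62 * (ℓ k : ℝ) ≤ a (k + 1) * ℓ (k + 1) := by
            rw [hlr]; nlinarith
          have h6 : (g k (ℓ (k + 1)) : ℝ) ≤ f (k + 1) (ℓ (k + 1)) := by linarith
          exact_mod_cast h6
        · intro n hn hn'
          have h4 := (abs_le.1 (hlane n (by omega))).1
          have h5 := (abs_le.1 (hfw' (k + 1) n hn')).2
          rw [hw] at h5
          have h6 : (f (k + 1) n : ℝ) ≤ f k n := by linarith
          exact_mod_cast h6
    -- The starting height depends on the labels, whence the countable union over `z`.
    refine Set.mem_iUnion.2 ⟨f 0 0, fun n => ?_⟩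
    obtain ⟨-, h, h1, -, h2, -⟩ := hreach n
    refine ⟨h, h1.sub le_rfl ?_, h2⟩
    have h3 : n < 2 ^ n := Nat.lt_two_pow_self
    have h4 : 1 * 2 ^ n ≤ scaleFactor M n := Nat.mul_le_mul_right _ (by omega)
    have h5 : scaleFactor M n ≤ ℓ n := scaleFactor_le_scaleLength hM2 hl
    omega
  have hbad : law (⋂ k, A k ∩ B k)ᶜ < 1 := by
    have h1 : ∀ k, law (A k ∩ B k)ᶜ ≤ ENNReal.ofReal ((1 / 4) ^ k * (1 / 32)) := by
      intro k
      have h2 : law.real (A k ∩ B k)ᶜ ≤ (1 / 4) ^ k * (1 / 32) := by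
        rw [Set.compl_inter]
        refine (measureReal_union_le _ _).trans ?_
        have h3 := (ha k).2.2.2 (y k) (hye k)
        have h4 := (tube_neg_compl_le (p := p) (s := 0) (y := y k + 16 * (ℓ k : ℤ)) (by
          simpa using (hye k).add ⟨8 * (ℓ k : ℤ), by ring⟩) (2 * ℓ (k + 1))
          (scaleWidth M l (k + 1)) (a (k + 1))).trans (ha (k + 1)).2.2.1
        have h5 := scaleBound_le (k := k) hM2
        have h6 := scaleBound_le (k := k + 1) hM2
        have h7 : (1 : ℝ) ≤ scaleFactor M (k + 1) := by
          exact_mod_cast (show 1 ≤ scaleFactor M (k + 1) from le_trans (by omega) le_scaleFactor)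
        have h8 := le_mul_of_one_le_left (scaleBound_nonneg (M := M) (k := k + 1)) h7
        have h9 : (0 : ℝ) < (1 / 4) ^ k := by positivity
        rw [pow_succ] at h6
        change law.real (A k)ᶜ + law.real (B k)ᶜ ≤ _
        change law.real (A k)ᶜ ≤ _ at h3
        change law.real (B k)ᶜ ≤ _ at h4
        nlinarith
      rw [← ofReal_measureReal]
      exact ENNReal.ofReal_le_ofReal h2
    rw [Set.compl_iInter]
    refine (measure_iUnion_le _).trans_lt ((ENNReal.tsum_le_tsum h1).trans_lt ?_)
    have hg : Summable fun k : ℕ => ((1 : ℝ) / 4) ^ k :=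
      summable_geometric_of_lt_one (by norm_num) (by norm_num)
    rw [← ENNReal.ofReal_tsum_of_nonneg (fun k => by positivity) (hg.mul_right _), tsum_mul_right,
      tsum_geometric_of_lt_one (by norm_num) (by norm_num)]
    rw [← ENNReal.ofReal_one]
    exact (ENNReal.ofReal_lt_ofReal_iff one_pos).2 (by norm_num)
  rw [pos_iff_ne_zero]
  intro h0
  have hnull : law (⋂ k, A k ∩ B k) = 0 :=
    measure_mono_null hchain (measure_iUnion_null fun z => law_infinite_paths_eq_zero h0 z)
  have h1 : (1 : ENNReal) ≤ law (⋂ k, A k ∩ B k) + law (⋂ k, A k ∩ B k)ᶜ := by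
    rw [← measure_univ (μ := law), ← Set.union_compl_self (⋂ k, A k ∩ B k)]
    exact measure_union_le _ _
  rw [hnull, zero_add] at h1
  exact absurd hbad (not_lt.2 h1)

/-- A positive lower bound on the edge speed persists, with percolation, slightly below `p`. -/
lemma exists_lt_le_edgeSpeed {b : ℝ} (hb : 0 < b) (hbp : (b : EReal) < edgeSpeed p) :
    ∃ p' < p, (b : EReal) ≤ edgeSpeed p' ∧ 0 < percolationProb p' := by
  have htop : edgeSpeed p ≠ ⊤ := ((edgeSpeed_le_one p).trans_lt (EReal.coe_lt_top 1)).ne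
  have hbot : edgeSpeed p ≠ ⊥ := ((EReal.bot_lt_coe b).trans hbp).ne'
  set α := (edgeSpeed p).toReal with hαdef
  have hα : edgeSpeed p = (α : EReal) := (EReal.coe_toReal htop hbot).symm
  have hα1 : α ≤ 1 := by
    have := edgeSpeed_le_one p
    rw [hα] at this
    exact_mod_cast this
  rw [hα, EReal.coe_lt_coe_iff] at hbp
  obtain ⟨M, hM⟩ := exists_nat_gt (max 2 (max (62 / b) (84 / (α - b))))
  simp only [max_lt_iff] at hM
  obtain ⟨hM2, hM62, hM84⟩ := hM
  have hM0 : (0 : ℝ) < M := by linarith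
  rw [div_lt_iff₀ hb] at hM62
  rw [div_lt_iff₀ (by linarith)] at hM84
  have hM2' : 2 ≤ M := by exact_mod_cast hM2.le
  have hgap : b + 84 / M ≤ α := by
    have : 84 / (M : ℝ) ≤ α - b := by rw [div_le_iff₀ hM0]; linarith
    linarith
  -- Half of the bound required at the initial scale; the other half absorbs the decrease of the
  -- parameter.
  have hκ : (0 : ℝ) < 1 / (512 * (M : ℝ) ^ 2) := by positivity
  obtain ⟨l, hl, hlt⟩ := exists_tube_compl_le hα (by linarith)
    (show (0 : ℝ) < 20 / M by positivity) hκ M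
  rw [div_mul_eq_mul_div, probReal_compl_eq_one_sub (measurableSet_tube _ _ _ _ _ _)] at hlt
  have hlim : Filter.Tendsto (fun k : ℕ =>
      law.real (tube (p - 1 / ((k : ℝ) + 1)) 0 0 (2 * l) (20 * l / M) α)) Filter.atTop
      (nhds (law.real (tube p 0 0 (2 * l) (20 * l / M) α))) := tendsto_pathEvent_left
  obtain ⟨k, hk⟩ := (hlim.eventually (lt_mem_nhds (sub_lt_self _ hκ))).exists
  have hq : law.real (tube (p - 1 / ((k : ℝ) + 1)) 0 0 (2 * l) (20 * l / M) α)ᶜ ≤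
      1 / (256 * (M : ℝ) ^ 2) := by
    rw [probReal_compl_eq_one_sub (measurableSet_tube _ _ _ _ _ _)]
    have : 1 / (256 * (M : ℝ) ^ 2) = 1 / (512 * (M : ℝ) ^ 2) + 1 / (512 * (M : ℝ) ^ 2) := by
      field_simp; norm_num
    linarith
  refine ⟨p - 1 / ((k : ℝ) + 1), ?_, ?_, ?_⟩
  · have : (0 : ℝ) < 1 / ((k : ℝ) + 1) := by positivity
    linarith
  · exact le_edgeSpeed_of_tube hb hα1 hM2' (by linarith) hl hgap hq
  · exact percolationProb_pos_of_tube hb hα1 hM2' (by linarith) hl hgap hq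

/-! ### The edge speed on the supercritical interval -/

lemma criticalValue_le (h0 : 0 < percolationProb p) (h1 : p ≤ 1) : criticalValue ≤ p :=
  csInf_le ⟨0, fun _ h => h.1.1⟩ ⟨⟨(pos_of_percolationProb_pos h0).le, h1⟩, h0⟩

/-- The speed at 1 is at least 1, so percolation persists slightly below 1. In particular the
infimum defining the critical value is over a nonempty set. -/
lemma exists_lt_one_percolationProb_pos : ∃ p < 1, 0 < percolationProb p := by
  obtain ⟨p, h1, -, h2⟩ := exists_lt_le_edgeSpeed (p := 1) (b := 1 / 2) (by norm_num)
    (lt_of_lt_of_le (by rw [← EReal.coe_one, EReal.coe_lt_coe_iff]; norm_num)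
      one_le_edgeSpeed_one)
  exact ⟨p, h1, h2⟩

lemma criticalValue_lt_one : criticalValue < 1 := by
  obtain ⟨p, h1, h2⟩ := exists_lt_one_percolationProb_pos
  exact (criticalValue_le h2 h1.le).trans_lt h1

lemma edgeSpeed_nonneg_of_criticalValue_lt (hp : criticalValue < p) : 0 ≤ edgeSpeed p := by
  have hne : {q : ℝ | q ∈ Set.Icc (0 : ℝ) 1 ∧ 0 < percolationProb q}.Nonempty := by
    obtain ⟨q, h1, h2⟩ := exists_lt_one_percolationProb_pos
    exact ⟨q, ⟨(pos_of_percolationProb_pos h2).le, h1.le⟩, h2⟩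
  obtain ⟨q, ⟨-, hq⟩, hqp⟩ := exists_lt_of_csInf_lt hne hp
  exact edgeSpeed_nonneg_of_percolationProb_pos (hq.trans_le (percolationProb_mono hqp.le))

/-- A positive speed would give percolation strictly below the critical value; a negative one would
persist slightly above it, where percolation forces a nonnegative speed. -/
lemma edgeSpeed_criticalValue : edgeSpeed criticalValue = 0 := by
  apply le_antisymm
  · by_contra hpos
    rw [not_le] at hpos
    obtain ⟨b, hb0, hb⟩ := EReal.lt_iff_exists_real_btwn.1 hpos
    obtain ⟨p', h1, -, h2⟩ := exists_lt_le_edgeSpeed (by exact_mod_cast hb0) hb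
    exact absurd (criticalValue_le h2 (h1.le.trans criticalValue_lt_one.le)) (not_le.2 h1)
  · by_contra hneg
    rw [not_le] at hneg
    obtain ⟨p', h1, h2⟩ := exists_gt_edgeSpeed_lt (c := 0) (by simpa using hneg)
    exact absurd (edgeSpeed_nonneg_of_criticalValue_lt h1) (not_le.2 (by simpa using h2))

lemma edgeSpeed_nonneg (hp : criticalValue ≤ p) : 0 ≤ edgeSpeed p :=
  edgeSpeed_criticalValue.symm.le.trans (edgeSpeed_mono hp)

lemma continuousOn_edgeSpeed : ContinuousOn edgeSpeed (Set.Icc criticalValue 1) := by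
  intro p hp
  rw [ContinuousWithinAt, tendsto_order]
  constructor
  · intro c hc
    -- Bounds `c < 0` hold trivially on the interval; this covers the left endpoint, where the
    -- persistence below `p` is not available.
    rcases lt_or_ge c 0 with h0 | h0
    · filter_upwards [self_mem_nhdsWithin] with q hq
      exact h0.trans_le (edgeSpeed_nonneg hq.1)
    · obtain ⟨b, hcb, hb⟩ := EReal.lt_iff_exists_real_btwn.1 hc
      have hb0 : 0 < b := by exact_mod_cast h0.trans_lt hcb
      obtain ⟨p', h1, h2, -⟩ := exists_lt_le_edgeSpeed hb0 hb
      filter_upwards [nhdsWithin_le_nhds (lt_mem_nhds h1)] with q hq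
      exact hcb.trans_le (h2.trans (edgeSpeed_mono hq.le))
  · intro c hc
    obtain ⟨b, hb, hbc⟩ := EReal.lt_iff_exists_real_btwn.1 hc
    obtain ⟨p', h1, h2⟩ := exists_gt_edgeSpeed_lt hb
    filter_upwards [nhdsWithin_le_nhds (gt_mem_nhds h1)] with q hq
    exact (edgeSpeed_mono hq.le).trans_lt (h2.trans hbc)

end OTSP

end

/-- The edge speed vanishes at the critical value; on `[p_c, 1]` it is finite and continuous. -/
theorem mainTheorem4 :
    OTSP.edgeSpeed OTSP.criticalValue = 0 ∧
      (∀ p ∈ Set.Icc OTSP.criticalValue 1,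
        OTSP.edgeSpeed p ≠ ⊥ ∧ OTSP.edgeSpeed p ≠ ⊤) ∧
      ContinuousOn OTSP.edgeSpeed (Set.Icc OTSP.criticalValue 1) := by
  refine ⟨OTSP.edgeSpeed_criticalValue, fun p hp => ⟨?_, ?_⟩, OTSP.continuousOn_edgeSpeed⟩
  · exact (EReal.bot_lt_zero.trans_le (OTSP.edgeSpeed_nonneg hp.1)).ne'
  · exact ((OTSP.edgeSpeed_le_one p).trans_lt (EReal.coe_lt_top 1)).ne
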